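/- Let $\Omega=[0,2\pi]^2$, and let $H$ be the space of real vector fields in $L^2(\Omega)^2$ that are $2\pi$-periodic in each direction, mean-free and divergence-free in the sense of distributions, with $|u|^2=\int_\Omega |u(x)|^2\,dx$. Let $V$ be the set of $u\in H$ with $\|u\|^2=\sum_{j=1,2}\int_\Omega|\partial_j u(x)|^2\,dx<\infty$. Let $\mathbb P$ be the orthogonal (Leray) projection onto $H$, $A=-\mathbb P\Delta$ the Stokes operator with domain $D(A)$, $B(u,v)=\mathbb P((u\cdot\nabla)v)$, and, for real $K>0$, let $P_K$ be the projection onto the Fourier wavenumbers $|k|\le K$. There is an absolute constant $C_1>0$ such that the following holds for every $\nu>0$ and every $K>0$. Let $g_1,g_2\in L^\infty(0,\infty;H)$ satisfy $|g_1(t)-g_2(t)|\to 0$ as $t\to\infty$ (a synchronous pair), and put $$\mathfrak g_j=\frac{\sup_{t\ge 0}|g_j(t)|}{\nu^2}\quad(j=1,2),\qquad \mathfrak g=(\mathfrak g_1^2+\mathfrak g_2^2)^{1/2},$$ where suprema and limits in time of the forces are taken up to null sets of times. Let $v=(v_1,v_2)$, with $v_i\in C([0,T];V)\cap L^2(0,T;D(A))$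 for all $T>0$, be a global solution of the symmetric direct-replacement intertwinement with $\theta_1=\theta_2=\tfrac12$, that is, of $$\frac{dv_1}{dt}+\nu Av_1+B(v_1,v_1)=g_1+\theta_1P_KB(v_1,v_1)-\theta_2P_KB(v_2,v_2),$$ $$\frac{dv_2}{dt}+\nu Av_2+B(v_2,v_2)=g_2-\theta_2P_KB(v_1,v_1)+\theta_1P_KB(v_2,v_2),$$ with arbitrary initial data in $V\times V$. Then $\|v(t)\|=(\|v_1(t)\|^2+\|v_2(t)\|^2)^{1/2}$ is bounded as $t\to\infty$ and $$\limsup_{t\to\infty}\|v(t)\|\le C_1\,\nu\,\mathfrak g .$$ -/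

import Mathlib

open Real MeasureTheory Filter Topology Set
open scoped ENNReal ContDiff

noncomputable section

namespace Intertwinement

/-- Points of the plane; fields on `ℝ²` that are `2π`-periodic in each variable are recorded by
their restriction to the period cell `Ω`. -/
abbrev Point : Type := Fin 2 → ℝ

/-- Values of vector fields, with the Euclidean norm. -/
abbrev Vec : Type := EuclideanSpace ℝ (Fin 2)

/-- The period cell `[0, 2π]²`. -/
def Ω : Set Point := Set.Icc 0 (fun _ => 2 * π)

/-- Real square-integrable periodic vector fields, with `(u, v) = ∫_Ω u · v` and `|u|² = (u, u)`. -/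
abbrev L2 : Type := Lp Vec 2 (volume.restrict Ω)

/-- Scalar test functions: smooth and `2π`-periodic in each direction. -/
structure IsTest (φ : Point → ℝ) : Prop where
  smooth : ContDiff ℝ ∞ φ
  periodic : ∀ (x : Point) (j : Fin 2), φ (x + Pi.single j (2 * π)) = φ x

/-- Classical partial derivative `∂_j φ`. -/
def partialDeriv (j : Fin 2) (φ : Point → ℝ) (x : Point) : ℝ :=
  fderiv ℝ φ x (Pi.single j 1)

/-- Constant fields and gradients of test functions. -/
def constantsAndGradients : Set L2 :=
  {w | (∃ c : Vec, w =ᵐ[volume.restrict Ω] fun _ => c) ∨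
    ∃ φ : Point → ℝ, IsTest φ ∧
      w =ᵐ[volume.restrict Ω] fun x => WithLp.toLp 2 (fun j => partialDeriv j φ x)}

/-- The space `H` of mean-free, divergence-free periodic `L²` fields: `u ∈ H` iff `∫_Ω u · c = 0`
for every constant `c` and `∫_Ω u · ∇φ = 0` for every test function `φ`. -/
def H : Submodule ℝ L2 := (Submodule.span ℝ constantsAndGradients)ᗮ

instance : CompleteSpace H :=
  inferInstanceAs (CompleteSpace (Submodule.span ℝ constantsAndGradients)ᗮ)

/-- The Leray projection: the orthogonal projection of `L²` onto `H`. -/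
def leray : L2 →L[ℝ] L2 := H.starProjection

/-- `w` is the distributional derivative `∂_j u` of the periodic field `u`. -/
def IsWeakDeriv (j : Fin 2) (u w : L2) : Prop :=
  ∀ φ : Point → ℝ, IsTest φ → ∀ i : Fin 2,
    ∫ x in Ω, u x i * partialDeriv j φ x = - ∫ x in Ω, w x i * φ x

open Classical in
/-- The distributional derivative `∂_j u` if it lies in `L²` (it is then unique), else `0`. -/
def weakDeriv (j : Fin 2) (u : L2) : L2 :=
  if h : ∃ w, IsWeakDeriv j u w then h.choose else 0

/-- The space `V`: elements of `H` with first-order distributional derivatives in `L²`. -/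
def V : Set L2 := {u | u ∈ H ∧ ∀ j, ∃ w, IsWeakDeriv j u w}

/-- The norm `‖u‖ = (∑_j ∫_Ω |∂_j u|²)^{1/2}` of `V`. -/
def normV (u : L2) : ℝ := √(∑ j, ‖weakDeriv j u‖ ^ 2)

/-- The Fourier coefficient `û_k = (2π)⁻² ∫_Ω u(x) e^{-i k·x} dx`, by components. -/
def fourierCoefficient (u : L2) (k : Fin 2 → ℤ) (i : Fin 2) : ℂ :=
  (1 / (2 * (π : ℂ)) ^ 2) *
    ∫ x in Ω, Complex.exp (-(Complex.I * ∑ j, (k j : ℂ) * (x j : ℂ))) * (u x i : ℂ)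

/-- The Euclidean length `|k|` of a wavenumber. -/
def waveLength (k : Fin 2 → ℤ) : ℝ := √(∑ j, (k j : ℝ) ^ 2)

/-- `w = ∑_k m(k) û_k e^{i k·x}`. -/
def IsMultiplier (m : (Fin 2 → ℤ) → ℝ) (u w : L2) : Prop :=
  ∀ k i, fourierCoefficient w k i = (m k : ℂ) * fourierCoefficient u k i

open Classical in
/-- The field `∑_k m(k) û_k e^{i k·x}` if it is in `L²` (it is then unique), else `0`. -/
def multiplier (m : (Fin 2 → ℤ) → ℝ) (u : L2) : L2 :=
  if h : ∃ w, IsMultiplier m u w then h.choose else 0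

/-- The domain `D(A)` of the Stokes operator. -/
def domainA : Set L2 := {u | u ∈ H ∧ ∃ w, IsMultiplier (fun k => waveLength k ^ 2) u w}

/-- The Stokes operator `A u = ∑_k |k|² û_k e^{i k·x}`. -/
def stokes (u : L2) : L2 := multiplier (fun k => waveLength k ^ 2) u

open Classical in
/-- The projection `P_K` onto the Fourier wavenumbers `|k| ≤ K`. -/
def lowModes (K : ℝ) (u : L2) : L2 := multiplier (fun k => if waveLength k ≤ K then 1 else 0) u

/-- The field `(u · ∇) v`. -/
def advection (u v : L2) (x : Point) : Vec :=
  WithLp.toLp 2 (fun i => ∑ j, u x j * weakDeriv j v x i)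

open Classical in
/-- The bilinear term `B(u, v) = ℙ((u · ∇) v)`, where `ℙ` is the Leray projection.  For `u ∈ D(A)`
and `v ∈ V` the field `(u · ∇) v` is in `L²`. -/
def B (u v : L2) : L2 :=
  if h : MemLp (advection u v) 2 (volume.restrict Ω) then leray h.toLp else 0

/-- The matrices coupling a symmetric direct-replacement intertwinement (used with
`θ₁ + θ₂ = 1`). -/
def symMatrix (θ₁ θ₂ : ℝ) : Matrix (Fin 2) (Fin 2) ℝ := !![θ₁, -θ₂; -θ₂, θ₁]

/-- `g = (g₁, g₂)` belongs to `L^∞(0, ∞; H)²`. -/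
def IsForce (g : Fin 2 → ℝ → L2) : Prop :=
  ∀ j, MemLp (g j) ∞ (volume.restrict (Ioi 0)) ∧
    ∀ᵐ t ∂(volume.restrict (Ioi (0 : ℝ))), g j t ∈ H

/-- `|g₁(t) - g₂(t)| → 0` as `t → ∞`; forces being defined for almost every time only, a null set
of times is disregarded. -/
def IsSynchronousPair (g : Fin 2 → ℝ → L2) : Prop :=
  Tendsto (fun t => ‖g 0 t - g 1 t‖) (atTop ⊓ ae volume) (𝓝 0)

/-- `𝔤 = (𝔤₁² + 𝔤₂²)^{1/2}`, where `𝔤_j = ν⁻² sup_{t ≥ 0} |g_j(t)|` (essential supremum). -/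
def forceSize (ν : ℝ) (g : Fin 2 → ℝ → L2) : ℝ :=
  √(∑ j, ((eLpNorm (g j) ∞ (volume.restrict (Ioi 0))).toReal / ν ^ 2) ^ 2)

/-- The time derivative of `v_i` prescribed by the direct-replacement intertwinement with matrix
`M`: `g_i - ν A v_i - B(v_i, v_i) + ∑_j m_{ij} P_K B(v_j, v_j)`. -/
def vectorField (ν K : ℝ) (M : Matrix (Fin 2) (Fin 2) ℝ) (g v : Fin 2 → ℝ → L2) (i : Fin 2)
    (t : ℝ) : L2 :=
  g i t - ν • stokes (v i t) - B (v i t) (v i t) +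
    ∑ j, M i j • lowModes K (B (v j t) (v j t))

/-- `v = (v₁, v₂)` is a global solution of the direct-replacement intertwinement: for every `T > 0`,
each `v_i` is in `C([0,T]; V) ∩ L²(0,T; D(A))`, is absolutely continuous in time with values in `H`,
and satisfies the system (as an identity in `H`, integrated in time). -/
structure IsSolution (ν K : ℝ) (M : Matrix (Fin 2) (Fin 2) ℝ) (g v : Fin 2 → ℝ → L2) : Prop where
  mem_V : ∀ i, ∀ t, 0 ≤ t → v i t ∈ V
  continuous_V : ∀ i, ∀ t₀, 0 ≤ t₀ →
    Tendsto (fun t => normV (v i t - v i t₀)) (𝓝[Ici 0] t₀) (𝓝 0)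
  mem_domainA : ∀ i, ∀ᵐ t ∂(volume.restrict (Ioi (0 : ℝ))), v i t ∈ domainA
  stokes_memLp : ∀ i, ∀ T : ℝ, 0 < T →
    MemLp (fun t => stokes (v i t)) 2 (volume.restrict (Ioo 0 T))
  integrable : ∀ i, ∀ t, 0 ≤ t → IntervalIntegrable (vectorField ν K M g v i) volume 0 t
  equation : ∀ i, ∀ t, 0 ≤ t → v i t = v i 0 + ∫ s in (0 : ℝ)..t, vectorField ν K M g v i s

/-- The norm `‖v‖ = (‖v₁‖² + ‖v₂‖²)^{1/2}` of a pair in `V × V`. -/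
def pairNormV (v : Fin 2 → L2) : ℝ := √(∑ i, normV (v i) ^ 2)

end Intertwinement

end

open scoped ComplexConjugate

noncomputable section

namespace Intertwinement

/-! Write `δ = v₁ - v₂`. With `θ₁ = θ₂ = 1/2` the nonlinear terms enter the equation for `δ` on the
modes `|k| ≤ K` with coefficients `∓(1 - θ₁ - θ₂) = 0`. Each such Fourier coefficient of `δ`
therefore solves a scalar heat equation, damped at rate `ν|k|²` and driven by `g₁ - g₂`. Since the
forces synchronize and the mean vanishes, it tends to zero
(`IsSolution.tendsto_fourierCoefficient_sub`). Only finitely many modes are involved, so the bound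
`lowModeSize K δ` for the supremum of `P_K A δ` tends to zero as well.

Now pair the equation for `v_i` with `A v_i` and add. On the two-dimensional torus `(B(u,u), Au) =
0` (`inner_advLp_stokes`), so the only nonlinear contribution is the coupling, and it collapses to
`½ (B(v₁,v₁) - B(v₂,v₂), P_K A δ)`. Putting the supremum norm on the last factor bounds this by a
vanishing multiple of `‖v‖²` (`abs_inner_B_le`), which viscosity eventually absorbs. What remains is
`d/dt ‖v‖² ≤ (G₁² + G₂²)/ν - (ν/2)‖v‖²`, where `G_j` is the essential supremum of `|g_j|`.
Gronwall's inequality gives `limsup ‖v‖² ≤ 2ν²𝔤²`. The time at which absorption starts depends on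
`K` and on the solution; the constant does not.

The analysis runs on Fourier coefficients: Parseval's identity (`hasSum_inner`) turns the operators
into multipliers, truncation gives smooth approximations, and the energy identity in `V`
(`normV_energy`) is obtained mode by mode and summed. -/

/-! ### Exponentials, trigonometric polynomials and test functions. -/

/-- The exponential `e^{i k·x}`. -/
def expMode (k : Fin 2 → ℤ) (x : Point) : ℂ :=
  Complex.exp (Complex.I * ∑ j, (k j : ℂ) * (x j : ℂ))

/-- The real trigonometric polynomial `Re ∑_{k ∈ s} c_k e^{i k·x}`. -/
def trig (s : Finset (Fin 2 → ℤ)) (c : (Fin 2 → ℤ) → ℂ) (x : Point) : ℝ :=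
  ∑ k ∈ s, (c k * expMode k x).re

lemma hasFDerivAt_expMode (k : Fin 2 → ℤ) (x : Point) :
    HasFDerivAt (expMode k) (expMode k x • (Complex.I • ∑ j, (k j : ℂ) •
      (Complex.ofRealCLM.comp (ContinuousLinearMap.proj (R := ℝ) (φ := fun _ : Fin 2 => ℝ) j)))) x := by
  unfold expMode
  refine HasFDerivAt.cexp ?_
  refine HasFDerivAt.const_mul ?_ _
  refine HasFDerivAt.fun_sum fun j _ => ?_
  refine HasFDerivAt.const_mul ?_ _
  exact (Complex.ofRealCLM.comp
    (ContinuousLinearMap.proj (R := ℝ) (φ := fun _ : Fin 2 => ℝ) j)).hasFDerivAt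

lemma contDiff_expMode (k : Fin 2 → ℤ) : ContDiff ℝ ∞ (expMode k) := by
  unfold expMode
  refine ContDiff.cexp (contDiff_const.mul (ContDiff.sum fun j _ => contDiff_const.mul ?_))
  exact (Complex.ofRealCLM.comp
    (ContinuousLinearMap.proj (R := ℝ) (φ := fun _ : Fin 2 => ℝ) j)).contDiff

lemma expMode_periodic (k : Fin 2 → ℤ) (x : Point) (j : Fin 2) :
    expMode k (x + Pi.single j (2 * π)) = expMode k x := by
  have h : Complex.I * ∑ i, (k i : ℂ) * ((x + Pi.single j (2 * π) : Point) i : ℂ)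
      = Complex.I * (∑ i, (k i : ℂ) * (x i : ℂ)) + (k j : ℂ) * (2 * π * Complex.I) := by
    simp only [Pi.add_apply, Complex.ofReal_add, mul_add, Finset.sum_add_distrib]
    congr 1
    fin_cases j <;> simp [Fin.sum_univ_two] <;> ring
  unfold expMode
  rw [h, Complex.exp_add, Complex.exp_int_mul_two_pi_mul_I, mul_one]

lemma norm_expMode (k : Fin 2 → ℤ) (x : Point) : ‖expMode k x‖ = 1 := by
  have h : Complex.I * ∑ j, (k j : ℂ) * (x j : ℂ) = ((∑ j, (k j : ℝ) * x j : ℝ) : ℂ) * Complex.I := by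
    push_cast; ring
  rw [expMode, h, Complex.norm_exp_ofReal_mul_I]

lemma conj_expMode (k : Fin 2 → ℤ) (x : Point) :
    conj (expMode k x) = Complex.exp (-(Complex.I * ∑ j, (k j : ℂ) * (x j : ℂ))) := by
  rw [expMode, ← Complex.exp_conj]
  simp

lemma expMode_neg (k : Fin 2 → ℤ) (x : Point) : expMode (-k) x = conj (expMode k x) := by
  rw [conj_expMode, expMode, ← mul_neg, ← Finset.sum_neg_distrib]
  simp only [Pi.neg_apply, Int.cast_neg, neg_mul]

lemma isTest_trig (s : Finset (Fin 2 → ℤ)) (c : (Fin 2 → ℤ) → ℂ) : IsTest (trig s c) where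
  smooth := by
    unfold trig
    exact ContDiff.sum fun k _ =>
      Complex.reCLM.contDiff.comp (contDiff_const.mul (contDiff_expMode k))
  periodic x j := by simp only [trig, expMode_periodic]

lemma partialDeriv_trig (s : Finset (Fin 2 → ℤ)) (c : (Fin 2 → ℤ) → ℂ) (j : Fin 2) (x : Point) :
    partialDeriv j (trig s c) x = trig s (fun k => Complex.I * k j * c k) x := by
  have h : HasFDerivAt (trig s c) _ x := HasFDerivAt.fun_sum fun k (_ : k ∈ s) =>
    Complex.reCLM.hasFDerivAt.comp x ((hasFDerivAt_expMode k x).const_mul (c k))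
  rw [partialDeriv, h.fderiv, _root_.sum_apply, trig]
  refine Finset.sum_congr rfl fun k _ => ?_
  simp only [ContinuousLinearMap.comp_apply, _root_.smul_apply,
    _root_.sum_apply, Complex.reCLM_apply, Complex.ofRealCLM_apply,
    ContinuousLinearMap.proj_apply, smul_eq_mul]
  congr 1
  rw [Finset.sum_eq_single j (fun i _ hi => by simp [Pi.single_eq_of_ne hi]) (by simp)]
  simp
  ring

lemma IsTest.continuous {φ : Point → ℝ} (h : IsTest φ) : Continuous φ := h.smooth.continuous

lemma IsTest.hasFDerivAt {φ : Point → ℝ} (h : IsTest φ) (x : Point) :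
    HasFDerivAt φ (fderiv ℝ φ x) x :=
  ((h.smooth.differentiable (by simp)) x).hasFDerivAt

lemma IsTest.mul {φ ψ : Point → ℝ} (h : IsTest φ) (h' : IsTest ψ) :
    IsTest (fun x => φ x * ψ x) where
  smooth := h.smooth.mul h'.smooth
  periodic x j := by simp only [h.periodic, h'.periodic]

lemma IsTest.sub {φ ψ : Point → ℝ} (h : IsTest φ) (h' : IsTest ψ) :
    IsTest (fun x => φ x - ψ x) where
  smooth := h.smooth.sub h'.smooth
  periodic x j := by simp only [h.periodic, h'.periodic]

lemma IsTest.const_mul {φ : Point → ℝ} (a : ℝ) (h : IsTest φ) : IsTest (fun x => a * φ x) where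
  smooth := contDiff_const.mul h.smooth
  periodic x j := by simp only [h.periodic]

lemma partialDeriv_mul {φ ψ : Point → ℝ} (h : IsTest φ) (h' : IsTest ψ) (j : Fin 2) (x : Point) :
    partialDeriv j (fun x => φ x * ψ x) x =
      partialDeriv j φ x * ψ x + φ x * partialDeriv j ψ x := by
  have := ((h.hasFDerivAt x).fun_mul (h'.hasFDerivAt x)).fderiv
  rw [partialDeriv, this]
  simp only [_root_.add_apply, _root_.smul_apply, smul_eq_mul,
    partialDeriv]
  ring

lemma partialDeriv_sub {φ ψ : Point → ℝ} (h : IsTest φ) (h' : IsTest ψ) (j : Fin 2) (x : Point) :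
    partialDeriv j (fun x => φ x - ψ x) x = partialDeriv j φ x - partialDeriv j ψ x := by
  have := ((h.hasFDerivAt x).fun_sub (h'.hasFDerivAt x)).fderiv
  rw [partialDeriv, this]
  rfl

lemma partialDeriv_const_mul {φ : Point → ℝ} (a : ℝ) (h : IsTest φ) (j : Fin 2) (x : Point) :
    partialDeriv j (fun x => a * φ x) x = a * partialDeriv j φ x := by
  have := ((h.hasFDerivAt x).const_mul a).fderiv
  rw [partialDeriv, this]
  rfl

lemma IsTest.continuous_partialDeriv {φ : Point → ℝ} (h : IsTest φ) (j : Fin 2) :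
    Continuous (partialDeriv j φ) :=
  (h.smooth.continuous_fderiv (by simp)).clm_apply continuous_const

/-! ### Integration over the period cell. -/

lemma isCompact_Ω : IsCompact Ω := isCompact_Icc

lemma measurableSet_Ω : MeasurableSet Ω := measurableSet_Icc

instance : IsFiniteMeasure (volume.restrict Ω) :=
  ⟨by rw [Measure.restrict_apply_univ]; exact isCompact_Ω.measure_lt_top⟩

/-- The integral over the period cell of a partial derivative of a periodic function vanishes. -/
lemma integral_partialDeriv_eq_zero {φ : Point → ℝ} (h : IsTest φ) (j : Fin 2) :
    ∫ x in Ω, partialDeriv j φ x = 0 := by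
  classical
  have key := integral_divergence_of_hasFDerivAt_off_countable' (n := 1) (E := ℝ)
    (0 : Point) (fun _ => 2 * π) (fun _ => by simp [Real.pi_pos.le])
    (fun i => if i = j then φ else 0) (fun i x => if i = j then fderiv ℝ φ x else 0) ∅
    countable_empty
    (fun i => by split_ifs; exacts [h.continuous.continuousOn, continuousOn_const])
    (fun x _ i => by
      split_ifs
      exacts [h.hasFDerivAt x, hasFDerivAt_const (0 : ℝ) x])
    (by
      refine (Continuous.continuousOn ?_).integrableOn_compact isCompact_Icc
      refine continuous_finsetSum _ fun i _ => ?_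
      split_ifs
      exacts [h.continuous_partialDeriv i, continuous_const])
  have h1 : ∀ x, ∑ i, (if i = j then fderiv ℝ φ x else 0) (Pi.single i 1 : Point)
      = partialDeriv j φ x := fun x => by
    rw [Finset.sum_eq_single j (fun i _ hi => by simp [hi]) (by simp)]
    simp [partialDeriv]
  simp only [h1] at key
  rw [Ω, key]
  refine Finset.sum_eq_zero fun i _ => ?_
  split_ifs with hi
  · subst hi
    rw [sub_eq_zero]
    congr 1
    ext y
    rw [← h.periodic (i.insertNth ((0 : Point) i) y) i]
    congr 1
    ext l
    rcases eq_or_ne l i with rfl | hl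
    · simp
    · obtain ⟨m, rfl⟩ := Fin.exists_succAbove_eq hl
      simp
  · simp

lemma integral_mul_partialDeriv {φ ψ : Point → ℝ} (h : IsTest φ) (h' : IsTest ψ) (j : Fin 2) :
    ∫ x in Ω, φ x * partialDeriv j ψ x = - ∫ x in Ω, partialDeriv j φ x * ψ x := by
  have := integral_partialDeriv_eq_zero (h.mul h') j
  simp only [partialDeriv_mul h h'] at this
  rw [integral_add] at this
  · linarith
  · exact ((h.continuous_partialDeriv j).mul h'.continuous).continuousOn.integrableOn_compact
      isCompact_Ω
  · exact (h.continuous.mul (h'.continuous_partialDeriv j)).continuousOn.integrableOn_compact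
      isCompact_Ω

lemma memLp_component (u : L2) (i : Fin 2) : MemLp (fun x => u x i) 2 (volume.restrict Ω) := by
  refine (Lp.memLp u).of_le ?_ (Eventually.of_forall fun x => PiLp.norm_apply_le (u x) i)
  exact (EuclideanSpace.proj (𝕜 := ℝ) i).continuous.comp_aestronglyMeasurable
    (Lp.aestronglyMeasurable u)

lemma integrable_component_mul (u : L2) (i : Fin 2) {φ : Point → ℝ} (hφ : Continuous φ) :
    Integrable (fun x => u x i * φ x) (volume.restrict Ω) := by
  have hφ' : MemLp φ 2 (volume.restrict Ω) := by
    obtain ⟨M, hM⟩ := isCompact_Ω.exists_bound_of_continuousOn hφ.continuousOn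
    exact MemLp.of_bound hφ.aestronglyMeasurable M
      ((ae_restrict_iff' measurableSet_Ω).2 (Eventually.of_forall hM))
  exact (memLp_component u i).integrable_mul hφ'

/-- Weak derivatives and `H` are defined through real test functions. This expresses a complex
coefficient through pairings with the real functions `Re(c e^{ik·x})`, and letting `c` vary recovers
it. -/
lemma re_mul_conj_fourierCoefficient (u : L2) (k : Fin 2 → ℤ) (i : Fin 2) (c : ℂ) :
    (2 * π) ^ 2 * (c * conj (fourierCoefficient u k i)).re
      = ∫ x in Ω, u x i * (c * expMode k x).re := by
  have hint : Integrable (fun x => expMode k x * (u x i : ℂ)) (volume.restrict Ω) := by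
    refine ((memLp_component u i).integrable (by norm_num)).ofReal.bdd_mul
      (c := 1) (contDiff_expMode k).continuous.aestronglyMeasurable
      (Eventually.of_forall fun x => (norm_expMode k x).le)
  have h1 : conj (fourierCoefficient u k i)
      = (1 / (2 * (π : ℂ)) ^ 2) * ∫ x in Ω, expMode k x * (u x i : ℂ) := by
    rw [fourierCoefficient, map_mul, ← integral_conj]
    simp only [map_mul, ← conj_expMode, Complex.conj_conj, Complex.conj_ofReal]
    congr 1
    simp [Complex.conj_ofNat]
  have h2 : ((2 * π) ^ 2 : ℝ) * (c * conj (fourierCoefficient u k i))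
      = ∫ x in Ω, c * (expMode k x * (u x i : ℂ)) := by
    rw [h1, integral_const_mul]
    push_cast
    have : (π : ℂ) ≠ 0 := by exact_mod_cast Real.pi_ne_zero
    field_simp
  have h3 := congrArg Complex.re h2
  rw [Complex.re_ofReal_mul] at h3
  rw [h3]
  have h4 := (Complex.reCLM.integral_comp_comm (hint.const_mul c))
  simp only [Complex.reCLM_apply] at h4
  rw [← h4]
  congr 1
  ext x
  rw [← mul_assoc, mul_comm _ (u x i : ℂ), Complex.re_ofReal_mul]

lemma eq_of_re_mul_conj_eq {a b : ℂ} (h : ∀ c : ℂ, (c * conj a).re = (c * conj b).re) : a = b := by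
  apply Complex.ext
  · simpa using h 1
  · simpa using h Complex.I

/-! ### Parseval's identity, transported from the unit torus. -/

section Torus

attribute [local instance] instMeasureSpaceUnitAddCircle

/-- The parametrization of the period cell by the unit torus. -/
def cellMap (θ : UnitAddTorus (Fin 2)) : Point :=
  (2 * π) • ((UnitAddTorus.measurableEquivPiIoc (0 : Fin 2 → ℝ) θ).1 : Point)

/-- Dilation by `2π` contributes the Jacobian `(2π)²`; the half-open cube that parametrizes the
torus differs from the closed cell by a null set. -/
lemma map_cellMap :
    MeasurePreserving cellMap volume
      (ENNReal.ofReal (((2 * π) ^ 2)⁻¹) • volume.restrict Ω) := by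
  have hpi : (2 * π : ℝ) ≠ 0 := by positivity
  have h1 := UnitAddTorus.measurePreserving_equivPiIoc (0 : Fin 2 → ℝ)
  have hs : MeasurableSet {x : Fin 2 → ℝ | ∀ i, x i ∈ Ioc ((0 : Fin 2 → ℝ) i) ((0 : Fin 2 → ℝ) i + 1)} :=
    MeasurableSet.univ_pi' (fun i => measurableSet_Ioc)
  have h2 : MeasurePreserving (Subtype.val :
      {x : Fin 2 → ℝ // ∀ i, x i ∈ Ioc ((0 : Fin 2 → ℝ) i) ((0 : Fin 2 → ℝ) i + 1)} → Point)
      (Measure.comap Subtype.val volume) (volume.restrict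
        {x : Fin 2 → ℝ | ∀ i, x i ∈ Ioc ((0 : Fin 2 → ℝ) i) ((0 : Fin 2 → ℝ) i + 1)}) :=
    ⟨measurable_subtype_coe, map_comap_subtype_coe hs volume⟩
  refine MeasurePreserving.comp (g := fun x : Point => (2 * π) • x) ⟨measurable_const_smul _, ?_⟩
    (h2.comp h1)
  set e : Point ≃ᵐ Point := (Homeomorph.smulOfNeZero (2 * π : ℝ) hpi).toMeasurableEquiv
  have he : ⇑e = fun x : Point => (2 * π) • x := rfl
  have hpre : {x : Fin 2 → ℝ | ∀ i, x i ∈ Ioc ((0 : Fin 2 → ℝ) i) ((0 : Fin 2 → ℝ) i + 1)}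
      = e ⁻¹' (Set.pi univ fun _ => Ioc 0 (2 * π)) := by
    ext x
    simp only [he, mem_ofPred_eq, mem_preimage, Set.mem_pi, mem_univ, true_implies, mem_Ioc,
      Pi.smul_apply, smul_eq_mul, Pi.zero_apply, zero_add]
    refine forall_congr' fun i => ?_
    have : 0 < 2 * π := by positivity
    constructor
    · rintro ⟨h, h'⟩
      exact ⟨by positivity, by nlinarith⟩
    · rintro ⟨h, h'⟩
      exact ⟨by by_contra hh; nlinarith, by by_contra hh; nlinarith⟩
  have hae : (Set.pi univ fun _ => Ioc 0 (2 * π) : Set Point) =ᵐ[volume] Ω := by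
    rw [volume_pi]
    exact Measure.univ_pi_Ioc_ae_eq_Icc
  rw [hpre, ← he, ← MeasurableEquiv.restrict_map, he,
    Measure.map_addHaar_smul volume hpi, Measure.restrict_smul, Measure.restrict_congr_set hae]
  congr 2
  rw [Module.finrank_fintype_fun_eq_card, Fintype.card_fin, abs_of_pos (by positivity)]

lemma expMode_cellMap (k : Fin 2 → ℤ) (θ : UnitAddTorus (Fin 2)) :
    expMode k (cellMap θ) = UnitAddTorus.mFourier k θ := by
  set y := UnitAddTorus.measurableEquivPiIoc (0 : Fin 2 → ℝ) θ with hy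
  have hθ : θ = fun i => ((y.1 i : ℝ) : UnitAddCircle) := by
    rw [← UnitAddTorus.coe_symm_measurableEquivPiIoc_apply, hy, MeasurableEquiv.symm_apply_apply]
  have hc : cellMap θ = (2 * π) • (y.1 : Point) := rfl
  rw [hc, hθ]
  change _ = ∏ i : Fin 2, fourier (k i) ((y.1 i : ℝ) : UnitAddCircle)
  simp only [fourier_coe_apply, ← Complex.exp_sum, expMode]
  congr 1
  rw [Finset.mul_sum]
  refine Finset.sum_congr rfl fun i _ => ?_
  simp
  ring

lemma integral_cellMap (F : Point → ℂ) (hF : AEStronglyMeasurable F (volume.restrict Ω)) :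
    ∫ θ, F (cellMap θ) = (1 / (2 * (π : ℂ)) ^ 2) * ∫ x in Ω, F x := by
  have h := map_cellMap
  rw [← integral_map h.measurable.aemeasurable (f := F) (by
    rw [h.map_eq]; exact hF.smul_measure _), h.map_eq, integral_smul_measure,
    ENNReal.toReal_ofReal (by positivity), Complex.real_smul]
  push_cast
  rw [one_div]

lemma memLp_component_cellMap (u : L2) (i : Fin 2) :
    MemLp (fun θ => (u (cellMap θ) i : ℂ)) 2 volume :=
  (((memLp_component u i).smul_measure ENNReal.ofReal_ne_top).comp_measurePreserving
    map_cellMap).ofReal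

lemma aestronglyMeasurable_component (u : L2) (i : Fin 2) :
    AEStronglyMeasurable (fun x => (u x i : ℂ)) (volume.restrict Ω) :=
  (memLp_component u i).ofReal.aestronglyMeasurable

lemma mFourierCoeff_component (u : L2) (k : Fin 2 → ℤ) (i : Fin 2) :
    UnitAddTorus.mFourierCoeff (memLp_component_cellMap u i).toLp k
      = fourierCoefficient u k i := by
  rw [fourierCoefficient, ← integral_cellMap (fun x => Complex.exp
    (-(Complex.I * ∑ j, (k j : ℂ) * (x j : ℂ))) * (u x i : ℂ)), UnitAddTorus.mFourierCoeff]
  · refine integral_congr_ae ?_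
    filter_upwards [(memLp_component_cellMap u i).coeFn_toLp] with θ hθ
    rw [hθ, ← conj_expMode, expMode_cellMap, ← UnitAddTorus.mFourier_neg, smul_eq_mul]
  · refine AEStronglyMeasurable.mul ?_ (aestronglyMeasurable_component u i)
    simp only [← conj_expMode]
    exact (Complex.continuous_conj.comp (contDiff_expMode k).continuous).aestronglyMeasurable

lemma inner_eq_sum_integral (u w : L2) :
    inner ℝ u w = ∑ i, ∫ x in Ω, u x i * w x i := by
  rw [L2.inner_def, ← integral_finsetSum]
  · refine integral_congr_ae (Eventually.of_forall fun x => ?_)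
    simp only [PiLp.inner_apply, RCLike.inner_apply, conj_trivial]
    exact Finset.sum_congr rfl fun i _ => mul_comm _ _
  · exact fun i _ => (memLp_component u i).integrable_mul (memLp_component w i)

/-- Parseval's identity on the period cell. -/
lemma hasSum_inner (u w : L2) :
    HasSum (fun k => (2 * π) ^ 2 *
      ∑ i, (fourierCoefficient u k i * conj (fourierCoefficient w k i)).re) (inner ℝ u w) := by
  rw [inner_eq_sum_integral]
  simp only [Finset.mul_sum]
  refine hasSum_sum fun i _ => ?_
  have h := UnitAddTorus.hasSum_prod_mFourierCoeff (memLp_component_cellMap w i).toLp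
    (memLp_component_cellMap u i).toLp
  simp only [mFourierCoeff_component] at h
  have h2 : ∫ θ, conj ((memLp_component_cellMap w i).toLp _ θ) *
      ((memLp_component_cellMap u i).toLp _ θ)
      = (1 / (2 * (π : ℂ)) ^ 2) * ((∫ x in Ω, u x i * w x i : ℝ) : ℂ) := by
    rw [← integral_complex_ofReal, ← integral_cellMap]
    · refine integral_congr_ae ?_
      filter_upwards [(memLp_component_cellMap u i).coeFn_toLp,
        (memLp_component_cellMap w i).coeFn_toLp] with θ hu hw
      rw [hu, hw, Complex.conj_ofReal]
      push_cast
      ring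
    · exact (((memLp_component u i).integrable_mul
        (memLp_component w i)).ofReal).aestronglyMeasurable
  rw [h2] at h
  have h3 := (Complex.hasSum_re h).mul_left ((2 * π) ^ 2)
  have h4 : (2 * π) ^ 2 * ((1 / (2 * (π : ℂ)) ^ 2) * ((∫ x in Ω, u x i * w x i : ℝ) : ℂ)).re
      = ∫ x in Ω, u x i * w x i := by
    have : (1 / (2 * (π : ℂ)) ^ 2) = ((1 / (2 * π) ^ 2 : ℝ) : ℂ) := by push_cast; rfl
    rw [this, Complex.re_ofReal_mul, Complex.ofReal_re]
    field_simp
  rw [h4] at h3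
  simpa only [mul_comm] using h3

end Torus

/-! ### Fourier coefficients as continuous functionals that separate fields. -/

lemma hasSum_norm_sq (u : L2) :
    HasSum (fun k => (2 * π) ^ 2 * ∑ i, ‖fourierCoefficient u k i‖ ^ 2) (‖u‖ ^ 2) := by
  have h := hasSum_inner u u
  rw [real_inner_self_eq_norm_sq] at h
  refine h.congr_fun fun k => ?_
  congr 1
  refine Finset.sum_congr rfl fun i _ => ?_
  rw [Complex.mul_conj, Complex.ofReal_re, Complex.normSq_eq_norm_sq]

lemma fourierCoefficient_add (u w : L2) (k : Fin 2 → ℤ) (i : Fin 2) :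
    fourierCoefficient (u + w) k i = fourierCoefficient u k i + fourierCoefficient w k i := by
  refine eq_of_re_mul_conj_eq fun c => ?_
  have hpi : ((2 * π) ^ 2 : ℝ) ≠ 0 := by positivity
  refine mul_left_cancel₀ hpi ?_
  have hc : Continuous fun x => (c * expMode k x).re :=
    Complex.continuous_re.comp (continuous_const.mul (contDiff_expMode k).continuous)
  rw [map_add, mul_add, Complex.add_re, mul_add]
  simp only [re_mul_conj_fourierCoefficient]
  rw [← integral_add (integrable_component_mul u i hc) (integrable_component_mul w i hc)]
  refine integral_congr_ae ?_
  filter_upwards [Lp.coeFn_add u w] with x hx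
  rw [hx, Pi.add_apply, PiLp.add_apply, add_mul]

lemma fourierCoefficient_smul (a : ℝ) (u : L2) (k : Fin 2 → ℤ) (i : Fin 2) :
    fourierCoefficient (a • u) k i = a * fourierCoefficient u k i := by
  refine eq_of_re_mul_conj_eq fun c => ?_
  have hpi : ((2 * π) ^ 2 : ℝ) ≠ 0 := by positivity
  refine mul_left_cancel₀ hpi ?_
  rw [map_mul, Complex.conj_ofReal, mul_left_comm, Complex.re_ofReal_mul, mul_left_comm]
  simp only [re_mul_conj_fourierCoefficient]
  rw [← integral_const_mul]
  refine integral_congr_ae ?_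
  filter_upwards [Lp.coeFn_smul a u] with x hx
  rw [hx, Pi.smul_apply, PiLp.smul_apply, smul_eq_mul, mul_assoc]

lemma norm_fourierCoefficient_le (u : L2) (k : Fin 2 → ℤ) (i : Fin 2) :
    ‖fourierCoefficient u k i‖ ≤ ‖u‖ := by
  have h := le_hasSum (hasSum_norm_sq u) k fun _ _ => by positivity
  have h2 : ‖fourierCoefficient u k i‖ ^ 2 ≤ ∑ i, ‖fourierCoefficient u k i‖ ^ 2 :=
    Finset.single_le_sum (f := fun i => ‖fourierCoefficient u k i‖ ^ 2)
      (fun i _ => by positivity) (Finset.mem_univ i)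
  have h3 : (1 : ℝ) ≤ (2 * π) ^ 2 := by nlinarith [Real.pi_gt_three]
  refine le_of_sq_le_sq ?_ (norm_nonneg u)
  calc _ ≤ ∑ i, ‖fourierCoefficient u k i‖ ^ 2 := h2
    _ ≤ (2 * π) ^ 2 * ∑ i, ‖fourierCoefficient u k i‖ ^ 2 :=
      le_mul_of_one_le_left (by positivity) h3
    _ ≤ _ := h

/-- The Fourier coefficient as a continuous linear functional. -/
def fourierCLM (k : Fin 2 → ℤ) (i : Fin 2) : L2 →L[ℝ] ℂ :=
  LinearMap.mkContinuous
    { toFun := fun u => fourierCoefficient u k i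
      map_add' := fun u w => fourierCoefficient_add u w k i
      map_smul' := fun a u => by simp [fourierCoefficient_smul] } 1
    (fun u => by simpa using norm_fourierCoefficient_le u k i)

lemma fourierCLM_apply (k : Fin 2 → ℤ) (i : Fin 2) (u : L2) :
    fourierCLM k i u = fourierCoefficient u k i := rfl

lemma fourierCoefficient_sub (u w : L2) (k : Fin 2 → ℤ) (i : Fin 2) :
    fourierCoefficient (u - w) k i = fourierCoefficient u k i - fourierCoefficient w k i :=
  map_sub (fourierCLM k i) u w

/-- A field is determined by its Fourier coefficients. -/
lemma eq_of_fourierCoefficient_eq {u w : L2}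
    (h : ∀ k i, fourierCoefficient u k i = fourierCoefficient w k i) : u = w := by
  have h1 := hasSum_norm_sq (u - w)
  simp only [fourierCoefficient_sub, h, sub_self, norm_zero] at h1
  have h2 : ‖u - w‖ ^ 2 = 0 := h1.unique (by simp [hasSum_zero])
  rw [← sub_eq_zero, ← norm_eq_zero]
  exact pow_eq_zero_iff (two_ne_zero) |>.1 h2

lemma fourierCoefficient_neg_index (u : L2) (k : Fin 2 → ℤ) (i : Fin 2) :
    fourierCoefficient u (-k) i = conj (fourierCoefficient u k i) := by
  refine eq_of_re_mul_conj_eq fun c => ?_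
  have hpi : ((2 * π) ^ 2 : ℝ) ≠ 0 := by positivity
  refine mul_left_cancel₀ hpi ?_
  have : (c * conj (conj (fourierCoefficient u k i))).re
      = (conj c * conj (fourierCoefficient u k i)).re := by
    rw [← Complex.conj_re]; simp
  rw [this]
  simp only [re_mul_conj_fourierCoefficient]
  congr 1
  ext x
  rw [expMode_neg]
  congr 1
  rw [← Complex.conj_re]; simp

/-! ### Fields with continuous components. -/

lemma memLp_of_continuous {f : Point → Vec} (hf : Continuous f) :
    MemLp f 2 (volume.restrict Ω) := by
  obtain ⟨M, hM⟩ := isCompact_Ω.exists_bound_of_continuousOn hf.continuousOn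
  exact MemLp.of_bound hf.aestronglyMeasurable M
    ((ae_restrict_iff' measurableSet_Ω).2 (Eventually.of_forall hM))

lemma continuous_toLp_field {f : Fin 2 → Point → ℝ} (h : ∀ i, Continuous (f i)) :
    Continuous fun x => (WithLp.toLp 2 (fun i => f i x) : Vec) :=
  (PiLp.continuous_toLp 2 (fun _ : Fin 2 => ℝ)).comp (continuous_pi h)

/-- The `L²` field with continuous components `f i`. -/
def fieldLp (f : Fin 2 → Point → ℝ) (h : ∀ i, Continuous (f i)) : L2 :=
  (memLp_of_continuous (continuous_toLp_field h)).toLp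

lemma coeFn_fieldLp (f : Fin 2 → Point → ℝ) (h : ∀ i, Continuous (f i)) :
    fieldLp f h =ᵐ[volume.restrict Ω] fun x => WithLp.toLp 2 (fun i => f i x) :=
  MemLp.coeFn_toLp _

lemma ae_fieldLp_apply (f : Fin 2 → Point → ℝ) (h : ∀ i, Continuous (f i)) :
    ∀ᵐ x ∂(volume.restrict Ω), ∀ i, fieldLp f h x i = f i x := by
  filter_upwards [coeFn_fieldLp f h] with x hx i
  rw [hx]

lemma two_pi_sq_pos : (0 : ℝ) < (2 * π) ^ 2 := by positivity

lemma fourierCoefficient_eq_of_forall_integral {u : L2} {k : Fin 2 → ℤ} {i : Fin 2} {a : ℂ}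
    (h : ∀ c : ℂ, ∫ x in Ω, u x i * (c * expMode k x).re = (2 * π) ^ 2 * (c * conj a).re) :
    fourierCoefficient u k i = a := by
  refine eq_of_re_mul_conj_eq fun c => mul_left_cancel₀ two_pi_sq_pos.ne' ?_
  rw [re_mul_conj_fourierCoefficient, h]

lemma isTest_re_expMode (k : Fin 2 → ℤ) (c : ℂ) : IsTest fun x => (c * expMode k x).re := by
  have h : trig {k} (fun _ => c) = fun x => (c * expMode k x).re := by
    ext x; simp [trig]
  exact h ▸ isTest_trig {k} fun _ => c

lemma partialDeriv_re_expMode (k : Fin 2 → ℤ) (c : ℂ) (j : Fin 2) (x : Point) :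
    partialDeriv j (fun x => (c * expMode k x).re) x = (Complex.I * k j * c * expMode k x).re := by
  have := partialDeriv_trig {k} (fun _ => c) j x
  have h : trig {k} (fun _ => c) = fun x => (c * expMode k x).re := by
    ext x; simp [trig]
  rw [← h, this]
  simp [trig]

/-! ### Weak derivatives and the space `H` in Fourier terms. -/

lemma IsWeakDeriv.fourierCoefficient_eq {j : Fin 2} {u w : L2} (h : IsWeakDeriv j u w)
    (k : Fin 2 → ℤ) (i : Fin 2) :
    fourierCoefficient w k i = Complex.I * k j * fourierCoefficient u k i := by
  refine fourierCoefficient_eq_of_forall_integral fun c => ?_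
  have h1 := h _ (isTest_re_expMode k c) i
  simp only [partialDeriv_re_expMode] at h1
  rw [← re_mul_conj_fourierCoefficient] at h1
  rw [← neg_eq_iff_eq_neg.2 h1, ← mul_neg, ← Complex.neg_re]
  congr 2
  simp only [map_mul, Complex.conj_I, map_intCast]
  ring

lemma inner_eq_zero_of_mem_H {u w : L2} (hu : u ∈ H) (hw : w ∈ constantsAndGradients) :
    inner ℝ w u = 0 :=
  (Submodule.mem_orthogonal _ _).1 hu w (Submodule.subset_span hw)

lemma fourierCoefficient_zero_of_mem_H {u : L2} (hu : u ∈ H) (i : Fin 2) :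
    fourierCoefficient u 0 i = 0 := by
  refine fourierCoefficient_eq_of_forall_integral fun c => ?_
  have hc : ∀ l : Fin 2, Continuous fun _ : Point => if l = i then c.re else 0 :=
    fun l => continuous_const
  have h := inner_eq_zero_of_mem_H hu (w := fieldLp (fun l _ => if l = i then c.re else 0) hc)
    (Or.inl ⟨WithLp.toLp 2 (fun l => if l = i then c.re else 0), coeFn_fieldLp _ hc⟩)
  rw [inner_eq_sum_integral, Finset.sum_eq_single i] at h
  · rw [map_zero, mul_zero, Complex.zero_re, mul_zero, ← h]
    refine integral_congr_ae ?_
    filter_upwards [ae_fieldLp_apply _ hc] with x hx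
    rw [hx]
    simp [expMode, mul_comm]
  · intro l _ hl
    refine integral_eq_zero_of_ae ?_
    filter_upwards [ae_fieldLp_apply _ hc] with x hx
    rw [hx]
    simp [hl]
  · simp

/-- Orthogonality to gradients is tested on the potential `Re(-i c e^{ik·x})`, whose `j`-th
derivative is `Re(k_j c e^{ik·x})`. -/
lemma sum_fourierCoefficient_of_mem_H {u : L2} (hu : u ∈ H) (k : Fin 2 → ℤ) :
    ∑ j, (k j : ℂ) * fourierCoefficient u k j = 0 := by
  refine eq_of_re_mul_conj_eq fun c => ?_
  have hφ := isTest_re_expMode k (-Complex.I * c)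
  have h := inner_eq_zero_of_mem_H hu (w := fieldLp _ fun j => hφ.continuous_partialDeriv j)
    (Or.inr ⟨_, hφ, coeFn_fieldLp _ _⟩)
  have h1 : ∀ j, ∫ x in Ω, (fieldLp _ fun j => hφ.continuous_partialDeriv j) x j * u x j
      = (2 * π) ^ 2 * (k j * c * conj (fourierCoefficient u k j)).re := by
    intro j
    rw [re_mul_conj_fourierCoefficient]
    refine integral_congr_ae ?_
    filter_upwards [ae_fieldLp_apply _ fun j => hφ.continuous_partialDeriv j] with x hx
    rw [hx, partialDeriv_re_expMode, mul_comm]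
    congr 3
    linear_combination (-(k j : ℂ) * c) * Complex.I_mul_I
  rw [inner_eq_sum_integral] at h
  simp only [h1, ← Finset.mul_sum] at h
  have h2 := (mul_eq_zero.1 h).resolve_left two_pi_sq_pos.ne'
  rw [map_zero, mul_zero, Complex.zero_re, ← h2, map_sum, Finset.mul_sum, Complex.re_sum]
  refine Finset.sum_congr rfl fun j _ => ?_
  congr 1
  simp only [map_mul, map_intCast]
  ring

/-- Fields with vanishing mean and `k · û_k = 0` are in `H`. -/
lemma mem_H_of_fourierCoefficient {u : L2} (h0 : ∀ i, fourierCoefficient u 0 i = 0)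
    (hdiv : ∀ k, ∑ j, (k j : ℂ) * fourierCoefficient u k j = 0) : u ∈ H := by
  rw [H, Submodule.mem_orthogonal]
  intro w hw
  induction hw using Submodule.span_induction with
  | zero => exact inner_zero_left _
  | add x y _ _ hx hy => rw [inner_add_left, hx, hy, add_zero]
  | smul a x _ hx => rw [real_inner_smul_left, hx, mul_zero]
  | mem w hw =>
    rcases hw with ⟨c, hc⟩ | ⟨φ, hφ, hw⟩
    · rw [inner_eq_sum_integral]
      refine Finset.sum_eq_zero fun i _ => ?_
      have h := re_mul_conj_fourierCoefficient u 0 i (c i : ℂ)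
      rw [h0, map_zero, mul_zero, Complex.zero_re, mul_zero] at h
      rw [h]
      refine integral_congr_ae ?_
      filter_upwards [hc] with x hx
      rw [hx]
      simp [expMode, mul_comm]
    -- Coefficients are defined for vector fields only, so the scalar `φ` is stored as the field
    -- `(φ, φ)` and `φ̂_k` is read off component `0`. Then `w = ∇φ` has coefficients `i k_j φ̂_k`,
    -- and each Parseval term contains the factor `k · û_k = 0`.
    · have hΦ : ∀ l : Fin 2, Continuous fun x : Point => φ x := fun _ => hφ.continuous
      have hcoef : ∀ k j, fourierCoefficient w k j
          = Complex.I * k j * fourierCoefficient (fieldLp (fun _ => φ) hΦ) k 0 := by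
        intro k j
        refine fourierCoefficient_eq_of_forall_integral fun c => ?_
        have h1 := integral_mul_partialDeriv (isTest_re_expMode k c) hφ j
        simp only [partialDeriv_re_expMode] at h1
        have h2 : ∫ x in Ω, w x j * (c * expMode k x).re
            = ∫ x in Ω, (c * expMode k x).re * partialDeriv j φ x := by
          refine integral_congr_ae ?_
          filter_upwards [hw] with x hx
          rw [hx, mul_comm]
        have h3 : ∫ x in Ω, (Complex.I * k j * c * expMode k x).re * φ x
            = ∫ x in Ω, fieldLp (fun _ => φ) hΦ x 0 * (Complex.I * k j * c * expMode k x).re := by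
          refine integral_congr_ae ?_
          filter_upwards [ae_fieldLp_apply (fun _ => φ) hΦ] with x hx
          rw [hx, mul_comm]
        rw [h2, h1, h3, ← re_mul_conj_fourierCoefficient, ← mul_neg, ← Complex.neg_re]
        congr 2
        simp only [map_mul, Complex.conj_I, map_intCast]
        ring
      have h := hasSum_inner w u
      refine h.unique ?_
      convert hasSum_zero with k
      have : ∑ i, (fourierCoefficient w k i * conj (fourierCoefficient u k i)).re
          = (Complex.I * fourierCoefficient (fieldLp (fun _ => φ) hΦ) k 0 *
              conj (∑ j, (k j : ℂ) * fourierCoefficient u k j)).re := by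
        rw [map_sum, Finset.mul_sum, Complex.re_sum]
        refine Finset.sum_congr rfl fun j _ => ?_
        rw [hcoef]
        congr 1
        simp only [map_mul, map_intCast]
        ring
      rw [this, hdiv, map_zero, mul_zero, Complex.zero_re, mul_zero]

/-! Real trigonometric fields with Hermitian coefficients. -/

section Torus

attribute [local instance] instMeasureSpaceUnitAddCircle

lemma integral_conj_expMode_mul (k l : Fin 2 → ℤ) :
    (1 / (2 * (π : ℂ)) ^ 2) * ∫ x in Ω, conj (expMode k x) * expMode l x
      = if k = l then 1 else 0 := by
  rw [← integral_cellMap]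
  · simp only [expMode_cellMap]
    have h := orthonormal_iff_ite.1 (UnitAddTorus.orthonormal_mFourier (d := Fin 2)) k l
    rw [ContinuousMap.inner_toLp] at h
    rw [← h]
    refine integral_congr_ae (Eventually.of_forall fun θ => ?_)
    simp only [mul_comm]
  · exact ((Complex.continuous_conj.comp (contDiff_expMode k).continuous).mul
      (contDiff_expMode l).continuous).aestronglyMeasurable

end Torus

/-- Hermitian coefficients on a symmetric set make the complex sum self-conjugate, so taking real
parts in `trig` loses nothing. -/
lemma ofReal_trig {s : Finset (Fin 2 → ℤ)} {c : (Fin 2 → ℤ) → ℂ} (hs : ∀ k ∈ s, -k ∈ s)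
    (hc : ∀ k, c (-k) = conj (c k)) (x : Point) :
    (trig s c x : ℂ) = ∑ k ∈ s, c k * expMode k x := by
  have h : conj (∑ k ∈ s, c k * expMode k x) = ∑ k ∈ s, c k * expMode k x := by
    rw [map_sum]
    refine Finset.sum_nbij' (fun k => -k) (fun k => -k) hs hs (by simp) (by simp) ?_
    intro k _
    rw [hc, expMode_neg, map_mul]
  rw [trig, ← Complex.re_sum]
  exact Complex.conj_eq_iff_re.1 h

/-- The real trigonometric field with coefficients `c i k`, as an `L²` field. -/
def trigLp (s : Finset (Fin 2 → ℤ)) (c : Fin 2 → (Fin 2 → ℤ) → ℂ) : L2 :=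
  fieldLp (fun i => trig s (c i)) fun i => (isTest_trig s (c i)).continuous

lemma ae_trigLp_apply (s : Finset (Fin 2 → ℤ)) (c : Fin 2 → (Fin 2 → ℤ) → ℂ) :
    ∀ᵐ x ∂(volume.restrict Ω), ∀ i, trigLp s c x i = trig s (c i) x :=
  ae_fieldLp_apply _ _

lemma fourierCoefficient_trigLp {s : Finset (Fin 2 → ℤ)} {c : Fin 2 → (Fin 2 → ℤ) → ℂ}
    (hs : ∀ k ∈ s, -k ∈ s) (hc : ∀ i k, c i (-k) = conj (c i k)) (k : Fin 2 → ℤ) (i : Fin 2) :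
    fourierCoefficient (trigLp s c) k i = if k ∈ s then c i k else 0 := by
  rw [fourierCoefficient]
  have h1 : ∫ x in Ω, Complex.exp (-(Complex.I * ∑ j, (k j : ℂ) * (x j : ℂ))) *
      (trigLp s c x i : ℂ) = ∑ l ∈ s, c i l * ∫ x in Ω, conj (expMode k x) * expMode l x := by
    simp only [← integral_const_mul]
    rw [← integral_finsetSum]
    · refine integral_congr_ae ?_
      filter_upwards [ae_trigLp_apply s c] with x hx
      rw [hx, ofReal_trig hs (hc i), ← conj_expMode, Finset.mul_sum]
      exact Finset.sum_congr rfl fun l _ => by ring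
    · intro l _
      exact ((continuous_const.mul ((Complex.continuous_conj.comp
        (contDiff_expMode k).continuous).mul
        (contDiff_expMode l).continuous)).continuousOn.integrableOn_compact isCompact_Ω)
  rw [h1, Finset.mul_sum]
  simp only [mul_left_comm _ (c i _), integral_conj_expMode_mul, mul_ite, mul_one, mul_zero,
    Finset.sum_ite_eq]

lemma isWeakDeriv_trigLp (s : Finset (Fin 2 → ℤ)) (c : Fin 2 → (Fin 2 → ℤ) → ℂ) (j : Fin 2) :
    IsWeakDeriv j (trigLp s c) (trigLp s fun i k => Complex.I * k j * c i k) := by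
  intro φ hφ i
  have h := integral_mul_partialDeriv (isTest_trig s (c i)) hφ j
  simp only [partialDeriv_trig] at h
  have h1 : ∫ x in Ω, trigLp s c x i * partialDeriv j φ x
      = ∫ x in Ω, trig s (c i) x * partialDeriv j φ x := by
    refine integral_congr_ae ?_
    filter_upwards [ae_trigLp_apply s c] with x hx
    rw [hx]
  have h2 : ∫ x in Ω, trigLp s (fun i k => Complex.I * k j * c i k) x i * φ x
      = ∫ x in Ω, trig s (fun k => Complex.I * k j * c i k) x * φ x := by
    refine integral_congr_ae ?_
    filter_upwards [ae_trigLp_apply s fun i k => Complex.I * k j * c i k] with x hx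
    rw [hx]
  rw [h1, h2, h]

/-! Fourier description of the operators. -/

lemma IsWeakDeriv.unique {j : Fin 2} {u w w' : L2} (h : IsWeakDeriv j u w)
    (h' : IsWeakDeriv j u w') : w = w' :=
  eq_of_fourierCoefficient_eq fun k i => by
    rw [h.fourierCoefficient_eq, h'.fourierCoefficient_eq]

lemma isWeakDeriv_weakDeriv {u : L2} (hu : u ∈ V) (j : Fin 2) :
    IsWeakDeriv j u (weakDeriv j u) := by
  rw [weakDeriv, dif_pos (hu.2 j)]
  exact (hu.2 j).choose_spec

lemma IsWeakDeriv.weakDeriv_eq {j : Fin 2} {u w : L2} (h : IsWeakDeriv j u w) :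
    weakDeriv j u = w := by
  have h' : ∃ w, IsWeakDeriv j u w := ⟨w, h⟩
  rw [weakDeriv, dif_pos h']
  exact h'.choose_spec.unique h

lemma fourierCoefficient_weakDeriv {u : L2} (hu : u ∈ V) (j : Fin 2) (k : Fin 2 → ℤ)
    (i : Fin 2) :
    fourierCoefficient (weakDeriv j u) k i = Complex.I * k j * fourierCoefficient u k i :=
  (isWeakDeriv_weakDeriv hu j).fourierCoefficient_eq k i

lemma isMultiplier_multiplier {m : (Fin 2 → ℤ) → ℝ} {u : L2} (h : ∃ w, IsMultiplier m u w) :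
    IsMultiplier m u (multiplier m u) := by
  rw [multiplier, dif_pos h]
  exact h.choose_spec

lemma fourierCoefficient_stokes {u : L2} (hu : u ∈ domainA) (k : Fin 2 → ℤ) (i : Fin 2) :
    fourierCoefficient (stokes u) k i = (waveLength k : ℂ) ^ 2 * fourierCoefficient u k i := by
  rw [stokes, isMultiplier_multiplier hu.2 k i]
  push_cast
  rfl

/-! ### Wavenumbers, and the norms of `V` and `D(A)` as weighted sums. -/

lemma waveLength_sq (k : Fin 2 → ℤ) : waveLength k ^ 2 = ∑ j, (k j : ℝ) ^ 2 :=
  Real.sq_sqrt (Finset.sum_nonneg fun _ _ => sq_nonneg _)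

lemma waveLength_neg (k : Fin 2 → ℤ) : waveLength (-k) = waveLength k := by
  simp [waveLength]

lemma waveLength_nonneg (k : Fin 2 → ℤ) : 0 ≤ waveLength k := Real.sqrt_nonneg _

lemma abs_le_waveLength (k : Fin 2 → ℤ) (j : Fin 2) : |(k j : ℝ)| ≤ waveLength k := by
  refine abs_le_of_sq_le_sq ?_ (waveLength_nonneg k)
  rw [waveLength_sq]
  exact Finset.single_le_sum (f := fun j => (k j : ℝ) ^ 2) (fun _ _ => sq_nonneg _)
    (Finset.mem_univ j)

lemma one_le_waveLength {k : Fin 2 → ℤ} (hk : k ≠ 0) : 1 ≤ waveLength k := by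
  obtain ⟨j, hj⟩ := Function.ne_iff.1 hk
  have h : (1 : ℝ) ≤ |(k j : ℝ)| := by
    exact_mod_cast Int.one_le_abs hj
  exact h.trans (abs_le_waveLength k j)

lemma finite_waveLength_le (R : ℝ) : {k : Fin 2 → ℤ | waveLength k ≤ R}.Finite := by
  refine (Set.finite_Icc (fun _ : Fin 2 => -⌈R⌉) (fun _ => ⌈R⌉)).subset fun k hk => ?_
  have h : ∀ j, |k j| ≤ ⌈R⌉ := fun j => by
    have := (abs_le_waveLength k j).trans (hk.trans (Int.le_ceil R))
    exact_mod_cast this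
  exact ⟨fun j => (abs_le.1 (h j)).1, fun j => (abs_le.1 (h j)).2⟩

/-- The wavenumbers of length at most `R`. -/
def modes (R : ℝ) : Finset (Fin 2 → ℤ) := (finite_waveLength_le R).toFinset

lemma mem_modes {R : ℝ} {k : Fin 2 → ℤ} : k ∈ modes R ↔ waveLength k ≤ R := by
  simp [modes]

lemma neg_mem_modes {R : ℝ} : ∀ k ∈ modes R, -k ∈ modes R := by
  simp [mem_modes, waveLength_neg]

lemma tendsto_modes : Tendsto (fun N : ℕ => modes N) atTop atTop := by
  refine tendsto_atTop_finset_of_monotone (fun M N h k hk => ?_) fun k => ?_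
  · rw [mem_modes] at *
    exact hk.trans (by exact_mod_cast h)
  · obtain ⟨N, hN⟩ := exists_nat_ge (waveLength k)
    exact ⟨N, mem_modes.2 hN⟩

open Classical in
-- The ball `|k| ≤ K` is finite, so the projected field is a trigonometric polynomial and the
-- default value of `multiplier` never occurs.
lemma fourierCoefficient_lowModes (K : ℝ) (u : L2) (k : Fin 2 → ℤ) (i : Fin 2) :
    fourierCoefficient (lowModes K u) k i
      = if waveLength k ≤ K then fourierCoefficient u k i else 0 := by
  have h : ∃ w, IsMultiplier (fun k => if waveLength k ≤ K then 1 else 0) u w := by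
    refine ⟨trigLp (modes K) fun i k => fourierCoefficient u k i, fun k i => ?_⟩
    rw [fourierCoefficient_trigLp neg_mem_modes fun i k => fourierCoefficient_neg_index u k i]
    simp only [mem_modes]
    split_ifs <;> simp
  rw [lowModes, isMultiplier_multiplier h k i]
  by_cases hk : waveLength k ≤ K <;> simp [hk]

lemma hasSum_normV_sq {u : L2} (hu : u ∈ V) :
    HasSum (fun k => (2 * π) ^ 2 * (waveLength k ^ 2 * ∑ i, ‖fourierCoefficient u k i‖ ^ 2))
      (normV u ^ 2) := by
  rw [normV, Real.sq_sqrt (Finset.sum_nonneg fun _ _ => sq_nonneg _)]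
  refine (hasSum_sum fun j (_ : j ∈ Finset.univ) => hasSum_norm_sq (weakDeriv j u)).congr_fun
    fun k => ?_
  rw [← Finset.mul_sum, waveLength_sq, Finset.sum_mul]
  congr 1
  refine Finset.sum_congr rfl fun j _ => ?_
  rw [Finset.mul_sum]
  refine Finset.sum_congr rfl fun i _ => ?_
  rw [fourierCoefficient_weakDeriv hu, norm_mul, norm_mul, Complex.norm_I, one_mul, mul_pow,
    Complex.norm_intCast, sq_abs]

lemma hasSum_stokes_norm_sq {u : L2} (hu : u ∈ domainA) :
    HasSum (fun k => (2 * π) ^ 2 * (waveLength k ^ 4 * ∑ i, ‖fourierCoefficient u k i‖ ^ 2))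
      (‖stokes u‖ ^ 2) := by
  refine (hasSum_norm_sq (stokes u)).congr_fun fun k => ?_
  rw [Finset.mul_sum]
  congr 1
  refine Finset.sum_congr rfl fun i _ => ?_
  rw [fourierCoefficient_stokes hu, norm_mul, norm_pow, Complex.norm_real,
    Real.norm_of_nonneg (waveLength_nonneg k)]
  ring

lemma normV_nonneg (u : L2) : 0 ≤ normV u := Real.sqrt_nonneg _

/-- Poincaré's inequality: the zero mode is absent and every other wavenumber has length at least
one. -/
lemma norm_le_normV {u : L2} (hu : u ∈ V) : ‖u‖ ≤ normV u := by
  refine le_of_sq_le_sq ?_ (normV_nonneg u)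
  refine hasSum_le (fun k => ?_) (hasSum_norm_sq u) (hasSum_normV_sq hu)
  refine mul_le_mul_of_nonneg_left ?_ two_pi_sq_pos.le
  by_cases hk : k = 0
  · subst hk
    simp [fourierCoefficient_zero_of_mem_H hu.1]
  · exact le_mul_of_one_le_left (by positivity) (one_le_pow₀ (one_le_waveLength hk))

lemma normV_le_norm_stokes {u : L2} (hu : u ∈ V) (hA : u ∈ domainA) : normV u ≤ ‖stokes u‖ := by
  refine le_of_sq_le_sq ?_ (norm_nonneg _)
  refine hasSum_le (fun k => ?_) (hasSum_normV_sq hu) (hasSum_stokes_norm_sq hA)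
  refine mul_le_mul_of_nonneg_left ?_ two_pi_sq_pos.le
  by_cases hk : k = 0
  · subst hk
    simp [fourierCoefficient_zero_of_mem_H hu.1]
  · exact mul_le_mul_of_nonneg_right
      (pow_le_pow_right₀ (one_le_waveLength hk) (by norm_num)) (by positivity)

lemma IsWeakDeriv.sub {j : Fin 2} {u u' w w' : L2} (h : IsWeakDeriv j u w)
    (h' : IsWeakDeriv j u' w') : IsWeakDeriv j (u - u') (w - w') := by
  intro φ hφ i
  have key : ∀ (a b : L2) {ψ : Point → ℝ}, Continuous ψ → ∫ x in Ω, (a - b : L2) x i * ψ x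
      = (∫ x in Ω, a x i * ψ x) - ∫ x in Ω, b x i * ψ x := by
    intro a b ψ hψ
    rw [← integral_sub (integrable_component_mul a i hψ) (integrable_component_mul b i hψ)]
    refine integral_congr_ae ?_
    filter_upwards [Lp.coeFn_sub a b] with x hx
    rw [hx, Pi.sub_apply, PiLp.sub_apply, sub_mul]
  rw [key u u' (hφ.continuous_partialDeriv j), key w w' hφ.continuous, h φ hφ i, h' φ hφ i]
  ring

lemma sub_mem_V {u w : L2} (hu : u ∈ V) (hw : w ∈ V) : u - w ∈ V :=
  ⟨H.sub_mem hu.1 hw.1, fun j =>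
    ⟨_, (isWeakDeriv_weakDeriv hu j).sub (isWeakDeriv_weakDeriv hw j)⟩⟩

lemma weakDeriv_sub {u w : L2} (hu : u ∈ V) (hw : w ∈ V) (j : Fin 2) :
    weakDeriv j (u - w) = weakDeriv j u - weakDeriv j w :=
  ((isWeakDeriv_weakDeriv hu j).sub (isWeakDeriv_weakDeriv hw j)).weakDeriv_eq

/-- On `V` this is the reverse triangle inequality for the Hilbert norm of the pair of weak
derivatives. -/
lemma abs_normV_sub_le {u w : L2} (hu : u ∈ V) (hw : w ∈ V) :
    |normV u - normV w| ≤ normV (u - w) := by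
  have h : ∀ z : L2, normV z = ‖(WithLp.toLp 2 fun j => weakDeriv j z : PiLp 2 fun _ : Fin 2 => L2)‖ :=
    fun z => by rw [PiLp.norm_eq_of_L2, normV]
  have h' : (WithLp.toLp 2 fun j => weakDeriv j (u - w) : PiLp 2 fun _ : Fin 2 => L2)
      = (WithLp.toLp 2 fun j => weakDeriv j u) - WithLp.toLp 2 fun j => weakDeriv j w := by
    rw [← WithLp.toLp_sub]
    congr 1
    ext1 j
    exact weakDeriv_sub hu hw j
  rw [h, h, h, h']
  exact abs_norm_sub_norm_le _ _

lemma norm_weakDeriv_le (u : L2) (j : Fin 2) : ‖weakDeriv j u‖ ≤ normV u := by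
  refine Real.le_sqrt_of_sq_le ?_
  exact Finset.single_le_sum (f := fun j => ‖weakDeriv j u‖ ^ 2) (fun _ _ => sq_nonneg _)
    (Finset.mem_univ j)

lemma stokes_mem_H {u : L2} (hu : u ∈ domainA) : stokes u ∈ H := by
  refine mem_H_of_fourierCoefficient (fun i => ?_) fun k => ?_
  · rw [fourierCoefficient_stokes hu, fourierCoefficient_zero_of_mem_H hu.1, mul_zero]
  · simp only [fourierCoefficient_stokes hu, mul_left_comm _ ((waveLength k : ℂ) ^ 2)]
    rw [← Finset.mul_sum, sum_fourierCoefficient_of_mem_H hu.1, mul_zero]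

lemma isMultiplier_sub {m : (Fin 2 → ℤ) → ℝ} {u u' w w' : L2} (h : IsMultiplier m u w)
    (h' : IsMultiplier m u' w') : IsMultiplier m (u - u') (w - w') := fun k i => by
  rw [fourierCoefficient_sub, fourierCoefficient_sub, h, h', mul_sub]

lemma IsMultiplier.unique {m : (Fin 2 → ℤ) → ℝ} {u w w' : L2} (h : IsMultiplier m u w)
    (h' : IsMultiplier m u w') : w = w' :=
  eq_of_fourierCoefficient_eq fun k i => by rw [h, h']

lemma isMultiplier_stokes {u : L2} (hu : u ∈ domainA) :
    IsMultiplier (fun k => waveLength k ^ 2) u (stokes u) := isMultiplier_multiplier hu.2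

lemma sub_mem_domainA {u w : L2} (hu : u ∈ domainA) (hw : w ∈ domainA) : u - w ∈ domainA :=
  ⟨H.sub_mem hu.1 hw.1, _, isMultiplier_sub (isMultiplier_stokes hu) (isMultiplier_stokes hw)⟩

lemma stokes_sub {u w : L2} (hu : u ∈ domainA) (hw : w ∈ domainA) :
    stokes (u - w) = stokes u - stokes w :=
  (isMultiplier_stokes (sub_mem_domainA hu hw)).unique
    (isMultiplier_sub (isMultiplier_stokes hu) (isMultiplier_stokes hw))

/-! Truncation to finitely many modes. -/

/-- The truncation of a field to the wavenumbers of length at most `R`. -/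
def trunc (R : ℝ) (u : L2) : L2 := trigLp (modes R) fun i k => fourierCoefficient u k i

lemma fourierCoefficient_trunc (R : ℝ) (u : L2) (k : Fin 2 → ℤ) (i : Fin 2) :
    fourierCoefficient (trunc R u) k i = if k ∈ modes R then fourierCoefficient u k i else 0 :=
  fourierCoefficient_trigLp neg_mem_modes (fun i k => fourierCoefficient_neg_index u k i) k i

lemma norm_sub_trunc_sq (R : ℝ) (u : L2) :
    ‖u - trunc R u‖ ^ 2 = ‖u‖ ^ 2 -
      ∑ k ∈ modes R, (2 * π) ^ 2 * ∑ i, ‖fourierCoefficient u k i‖ ^ 2 := by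
  have h1 := (hasSum_norm_sq u).sub (hasSum_sum_of_ne_finset_zero (s := modes R)
    (f := fun k => if k ∈ modes R then (2 * π) ^ 2 * ∑ i, ‖fourierCoefficient u k i‖ ^ 2 else 0)
    (fun k hk => if_neg hk))
  rw [Finset.sum_congr rfl (fun k hk => if_pos hk)] at h1
  refine (hasSum_norm_sq (u - trunc R u)).unique (h1.congr_fun fun k => ?_)
  simp only [fourierCoefficient_sub, fourierCoefficient_trunc]
  split_ifs <;> simp

lemma tendsto_trunc (u : L2) : Tendsto (fun N : ℕ => trunc N u) atTop (𝓝 u) := by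
  rw [tendsto_iff_norm_sub_tendsto_zero]
  have h : Tendsto (fun N : ℕ => ‖u - trunc N u‖ ^ 2) atTop (𝓝 0) := by
    simp only [norm_sub_trunc_sq]
    have h1 : Tendsto (fun N : ℕ => ∑ k ∈ modes N, (2 * π) ^ 2 *
        ∑ i, ‖fourierCoefficient u k i‖ ^ 2) atTop (𝓝 (‖u‖ ^ 2)) :=
      (hasSum_norm_sq u).comp tendsto_modes
    have h2 := (tendsto_const_nhds (x := ‖u‖ ^ 2)).sub h1
    rwa [sub_self] at h2
  have h2 := (Real.continuous_sqrt.tendsto 0).comp h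
  simpa [Function.comp_def, Real.sqrt_sq (norm_nonneg _), norm_sub_rev] using h2

lemma trunc_mem_H {u : L2} (hu : u ∈ H) (R : ℝ) : trunc R u ∈ H := by
  refine mem_H_of_fourierCoefficient (fun i => ?_) fun k => ?_
  · rw [fourierCoefficient_trunc, fourierCoefficient_zero_of_mem_H hu, ite_self]
  · simp only [fourierCoefficient_trunc]
    split_ifs
    · exact sum_fourierCoefficient_of_mem_H hu k
    · simp

lemma trunc_mem_V {u : L2} (hu : u ∈ H) (R : ℝ) : trunc R u ∈ V :=
  ⟨trunc_mem_H hu R, fun j => ⟨_, isWeakDeriv_trigLp _ _ j⟩⟩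

lemma weakDeriv_trunc (u : L2) (R : ℝ) (j : Fin 2) :
    weakDeriv j (trunc R u)
      = trigLp (modes R) fun i k => Complex.I * k j * fourierCoefficient u k i :=
  (isWeakDeriv_trigLp _ _ j).weakDeriv_eq

lemma isMultiplier_trunc {m : (Fin 2 → ℤ) → ℝ} {u w : L2} (h : IsMultiplier m u w) (R : ℝ) :
    IsMultiplier m (trunc R u) (trunc R w) := fun k i => by
  rw [fourierCoefficient_trunc, fourierCoefficient_trunc, h]
  split_ifs <;> simp

lemma trunc_mem_domainA {u : L2} (hu : u ∈ domainA) (R : ℝ) : trunc R u ∈ domainA :=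
  ⟨trunc_mem_H hu.1 R, _, isMultiplier_trunc (isMultiplier_stokes hu) R⟩

lemma stokes_trunc {u : L2} (hu : u ∈ domainA) (R : ℝ) :
    stokes (trunc R u) = trunc R (stokes u) :=
  (isMultiplier_stokes (trunc_mem_domainA hu R)).unique
    (isMultiplier_trunc (isMultiplier_stokes hu) R)

/-! The supremum bound for fields in the domain of the Stokes operator. -/

/-- The exponent `4` exceeds the lattice rank `2`; the Euclidean length dominates the maximum norm,
for which summability is known. -/
lemma summable_waveLength_inv : Summable fun k : Fin 2 → ℤ => (waveLength k ^ 4)⁻¹ := by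
  have h := EisensteinSeries.summable_one_div_norm_rpow (k := 4) (by norm_num)
  refine h.of_nonneg_of_le (fun k => by have := waveLength_nonneg k; positivity) fun k => ?_
  rw [Real.rpow_neg (norm_nonneg _)]
  have h4 : ‖k‖ ^ (4 : ℝ) = ‖k‖ ^ 4 := by exact_mod_cast Real.rpow_natCast ‖k‖ 4
  rw [h4]
  by_cases hk : k = 0
  · subst hk; simp [waveLength]
  · have h0 : 0 < ‖k‖ := norm_pos_iff.2 hk
    refine inv_anti₀ (by positivity) (pow_le_pow_left₀ (norm_nonneg _) ?_ 4)
    refine (pi_norm_le_iff_of_nonneg (waveLength_nonneg k)).2 fun j => ?_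
    rw [Int.norm_eq_abs]
    exact abs_le_waveLength k j

lemma abs_trig_le (s : Finset (Fin 2 → ℤ)) (c : (Fin 2 → ℤ) → ℂ) (x : Point) :
    |trig s c x| ≤ ∑ k ∈ s, ‖c k‖ := by
  refine (Finset.abs_sum_le_sum_abs _ _).trans (Finset.sum_le_sum fun k _ => ?_)
  refine (Complex.abs_re_le_norm _).trans ?_
  rw [norm_mul, norm_expMode, mul_one]

/-- Cauchy–Schwarz applied to `|û_k| = |k|⁻² · |k|²|û_k|`; the sum of `|k|⁻⁴` converges in two
dimensions. -/
lemma sum_norm_fourierCoefficient_le {u : L2} (hu : u ∈ domainA) (s : Finset (Fin 2 → ℤ))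
    (i : Fin 2) :
    ∑ k ∈ s, ‖fourierCoefficient u k i‖
      ≤ √(∑' k : Fin 2 → ℤ, (waveLength k ^ 4)⁻¹) * ‖stokes u‖ := by
  have h1 : ∀ k, ‖fourierCoefficient u k i‖
      = (waveLength k ^ 2)⁻¹ * ‖fourierCoefficient (stokes u) k i‖ := by
    intro k
    rw [fourierCoefficient_stokes hu, norm_mul, norm_pow, Complex.norm_real,
      Real.norm_of_nonneg (waveLength_nonneg k)]
    by_cases hk : k = 0
    · subst hk
      rw [fourierCoefficient_zero_of_mem_H hu.1]; simp
    · have := one_le_waveLength hk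
      field_simp
  simp only [h1]
  refine (Real.sum_mul_le_sqrt_mul_sqrt s _ _).trans ?_
  refine mul_le_mul (Real.sqrt_le_sqrt ?_) ?_ (Real.sqrt_nonneg _) (Real.sqrt_nonneg _)
  · have : ∀ k : Fin 2 → ℤ, ((waveLength k ^ 2)⁻¹) ^ 2 = (waveLength k ^ 4)⁻¹ := fun k => by
      rw [inv_pow, ← pow_mul]
    simp only [this]
    exact summable_waveLength_inv.sum_le_tsum s
      fun k _ => by have := waveLength_nonneg k; positivity
  · rw [Real.sqrt_le_left (norm_nonneg _)]
    refine le_trans ?_ (sum_le_hasSum s (fun k _ => by positivity) (hasSum_norm_sq (stokes u)))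
    refine Finset.sum_le_sum fun k _ => ?_
    have h2 : ‖fourierCoefficient (stokes u) k i‖ ^ 2
        ≤ ∑ i, ‖fourierCoefficient (stokes u) k i‖ ^ 2 :=
      Finset.single_le_sum (f := fun i => ‖fourierCoefficient (stokes u) k i‖ ^ 2)
        (fun i _ => by positivity) (Finset.mem_univ i)
    have h3 : (1 : ℝ) ≤ (2 * π) ^ 2 := by nlinarith [Real.pi_gt_three]
    exact h2.trans (le_mul_of_one_le_left (by positivity) h3)

/-- The set of fields whose components are bounded by `M` is closed in `L²`. -/
lemma ae_abs_le_of_tendsto {w : ℕ → L2} {u : L2} {M : ℝ} (h : Tendsto w atTop (𝓝 u))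
    (hM : ∀ n, ∀ᵐ x ∂(volume.restrict Ω), ∀ i, |w n x i| ≤ M) :
    ∀ᵐ x ∂(volume.restrict Ω), ∀ i, |u x i| ≤ M := by
  obtain ⟨ns, _, hns⟩ := (tendstoInMeasure_of_tendsto_Lp h).exists_seq_tendsto_ae
  filter_upwards [hns, ae_all_iff.2 hM] with x hx hMx i
  have h1 : Tendsto (fun n => |w (ns n) x i|) atTop (𝓝 |u x i|) :=
    (continuous_abs.comp (EuclideanSpace.proj (𝕜 := ℝ) i).continuous).continuousAt.tendsto.comp hx
  exact le_of_tendsto' h1 fun n => hMx (ns n) i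

/-- Fields in `D(A)` are bounded, by a multiple of `|A u|`. -/
lemma exists_ae_abs_le_norm_stokes :
    ∃ C : ℝ, 0 ≤ C ∧ ∀ u ∈ domainA, ∀ᵐ x ∂(volume.restrict Ω), ∀ i,
      |u x i| ≤ C * ‖stokes u‖ := by
  refine ⟨√(∑' k : Fin 2 → ℤ, (waveLength k ^ 4)⁻¹), Real.sqrt_nonneg _, fun u hu => ?_⟩
  refine ae_abs_le_of_tendsto (tendsto_trunc u) fun N => ?_
  filter_upwards [ae_trigLp_apply (modes N) fun i k => fourierCoefficient u k i] with x hx i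
  rw [trunc, hx]
  exact (abs_trig_le _ _ _).trans (sum_norm_fourierCoefficient_le hu _ i)

/-! The advection term. -/

open Classical in
/-- The field `(u · ∇) v` as an element of `L²`. -/
def advLp (u v : L2) : L2 :=
  if h : MemLp (advection u v) 2 (volume.restrict Ω) then h.toLp else 0

lemma B_eq_leray (u v : L2) : B u v = leray (advLp u v) := by
  unfold B advLp
  split_ifs
  · rfl
  · rw [map_zero]

lemma advection_eq_sum (u v : L2) (x : Point) :
    advection u v x = ∑ j, u x j • weakDeriv j v x := by
  ext i
  simp [advection]

lemma memLp_smul_of_ae_le {u w : L2} {M : ℝ} {j : Fin 2}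
    (hM : ∀ᵐ x ∂(volume.restrict Ω), ∀ i, |u x i| ≤ M) :
    MemLp (fun x => u x j • w x) 2 (volume.restrict Ω) := by
  refine MemLp.of_le_mul (c := M) (Lp.memLp w)
    ((memLp_component u j).aestronglyMeasurable.smul (Lp.aestronglyMeasurable w)) ?_
  filter_upwards [hM] with x hx
  rw [norm_smul]
  exact mul_le_mul_of_nonneg_right (hx j) (norm_nonneg _)

lemma norm_smul_toLp_le {u w : L2} {M : ℝ} {j : Fin 2}
    (hM : ∀ᵐ x ∂(volume.restrict Ω), ∀ i, |u x i| ≤ M) :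
    ‖(memLp_smul_of_ae_le (w := w) (j := j) hM).toLp‖ ≤ M * ‖w‖ := by
  refine Lp.norm_le_mul_norm_of_ae_le_mul ?_
  filter_upwards [hM, (memLp_smul_of_ae_le (w := w) (j := j) hM).coeFn_toLp] with x hx h
  rw [h, norm_smul]
  exact mul_le_mul_of_nonneg_right (hx j) (norm_nonneg _)

lemma memLp_advection {u : L2} {M : ℝ} (hM : ∀ᵐ x ∂(volume.restrict Ω), ∀ i, |u x i| ≤ M)
    (v : L2) : MemLp (advection u v) 2 (volume.restrict Ω) := by
  have h := memLp_finsetSum Finset.univ fun j (_ : j ∈ Finset.univ) =>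
    memLp_smul_of_ae_le (w := weakDeriv j v) (j := j) hM
  refine h.ae_eq (Eventually.of_forall fun x => ?_)
  rw [advection_eq_sum]

lemma coeFn_advLp {u : L2} {M : ℝ} (hM : ∀ᵐ x ∂(volume.restrict Ω), ∀ i, |u x i| ≤ M)
    (v : L2) : advLp u v =ᵐ[volume.restrict Ω] advection u v := by
  rw [advLp, dif_pos (memLp_advection hM v)]
  exact MemLp.coeFn_toLp _

lemma norm_advLp_le {u : L2} {M : ℝ} (hM0 : 0 ≤ M)
    (hM : ∀ᵐ x ∂(volume.restrict Ω), ∀ i, |u x i| ≤ M) (v : L2) :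
    ‖advLp u v‖ ≤ 2 * M * normV v := by
  have h : advLp u v = ∑ j, (memLp_smul_of_ae_le (w := weakDeriv j v) (j := j) hM).toLp := by
    rw [Fin.sum_univ_two]
    ext1
    filter_upwards [coeFn_advLp hM v, Lp.coeFn_add
      (memLp_smul_of_ae_le (w := weakDeriv 0 v) (j := 0) hM).toLp
      (memLp_smul_of_ae_le (w := weakDeriv 1 v) (j := 1) hM).toLp,
      (memLp_smul_of_ae_le (w := weakDeriv 0 v) (j := 0) hM).coeFn_toLp,
      (memLp_smul_of_ae_le (w := weakDeriv 1 v) (j := 1) hM).coeFn_toLp] with x h1 h2 h3 h4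
    rw [h1, h2, Pi.add_apply, h3, h4, advection_eq_sum, Fin.sum_univ_two]
  rw [h]
  refine (norm_sum_le _ _).trans ?_
  calc _ ≤ ∑ _j : Fin 2, M * normV v := Finset.sum_le_sum fun j _ =>
        (norm_smul_toLp_le hM).trans (mul_le_mul_of_nonneg_left (norm_weakDeriv_le v j) hM0)
    _ = _ := by simp; ring

lemma norm_leray_le (u : L2) : ‖leray u‖ ≤ ‖u‖ := H.norm_starProjection_apply_le u

lemma inner_leray {w : L2} (u : L2) (hw : w ∈ H) : inner ℝ (leray u) w = inner ℝ u w := by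
  rw [leray, Submodule.inner_starProjection_left_eq_right,
    Submodule.starProjection_eq_self_iff.2 hw]

lemma integral_norm_sq (u : L2) : ∫ x in Ω, ‖u x‖ ^ 2 = ‖u‖ ^ 2 := by
  rw [← real_inner_self_eq_norm_sq, L2.inner_def]
  simp only [real_inner_self_eq_norm_sq]

lemma integrable_norm_sq (u : L2) : Integrable (fun x => ‖u x‖ ^ 2) (volume.restrict Ω) := by
  simpa only [real_inner_self_eq_norm_sq] using L2.integrable_inner (𝕜 := ℝ) u u

/-- All of the supremum norm falls on `φ`, leaving `|u||∇u|`, which Young's and Poincaré's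
inequalities bound by `‖u‖²`. The bound `M` serves only to make the advection term square-integrable
and does not enter the estimate. -/
lemma abs_inner_advLp_le {u φ : L2} (hu : u ∈ V) {M P : ℝ}
    (hM : ∀ᵐ x ∂(volume.restrict Ω), ∀ i, |u x i| ≤ M) (hP0 : 0 ≤ P)
    (hP : ∀ᵐ x ∂(volume.restrict Ω), ∀ i, |φ x i| ≤ P) :
    |inner ℝ (advLp u u) φ| ≤ 2 * P * normV u ^ 2 := by
  have hint : Integrable (fun x => P * (‖u x‖ ^ 2 + ∑ j, ‖weakDeriv j u x‖ ^ 2))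
      (volume.restrict Ω) :=
    ((integrable_norm_sq u).add (integrable_finsetSum _ fun j _ =>
      integrable_norm_sq (weakDeriv j u))).const_mul P
  have h1 : |inner ℝ (advLp u u) φ| ≤ ∫ x in Ω, P * (‖u x‖ ^ 2 + ∑ j, ‖weakDeriv j u x‖ ^ 2) := by
    rw [L2.inner_def, ← Real.norm_eq_abs]
    refine norm_integral_le_of_norm_le hint ?_
    filter_upwards [coeFn_advLp hM u, hP] with x hx hPx
    rw [hx, Real.norm_eq_abs]
    have key : ∀ a b p : ℝ, |p| ≤ P → |a * b * p| ≤ P * (a ^ 2 / 2 + b ^ 2 / 2) := by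
      intro a b p hp
      rw [abs_mul, mul_comm]
      refine mul_le_mul hp ?_ (abs_nonneg _) hP0
      rw [abs_mul]
      nlinarith [sq_nonneg (|a| - |b|), sq_abs a, sq_abs b]
    have hin : inner ℝ (advection u u x) (φ x)
        = ∑ i, ∑ j, u x j * weakDeriv j u x i * φ x i := by
      simp only [PiLp.inner_apply, RCLike.inner_apply, conj_trivial, advection, Finset.mul_sum]
      exact Finset.sum_congr rfl fun i _ => Finset.sum_congr rfl fun j _ => by ring
    rw [hin]
    have h2 := fun i j => key (u x j) (weakDeriv j u x i) (φ x i) (hPx i)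
    simp only [EuclideanSpace.norm_sq_eq, Fin.sum_univ_two, Real.norm_eq_abs, sq_abs]
    have := abs_add_le (u x 0 * weakDeriv 0 u x 0 * φ x 0 + u x 1 * weakDeriv 1 u x 0 * φ x 0)
      (u x 0 * weakDeriv 0 u x 1 * φ x 1 + u x 1 * weakDeriv 1 u x 1 * φ x 1)
    have h3 := abs_add_le (u x 0 * weakDeriv 0 u x 0 * φ x 0) (u x 1 * weakDeriv 1 u x 0 * φ x 0)
    have h4 := abs_add_le (u x 0 * weakDeriv 0 u x 1 * φ x 1) (u x 1 * weakDeriv 1 u x 1 * φ x 1)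
    have h5 : 0 ≤ P * ((weakDeriv 0 u x 0) ^ 2 + (weakDeriv 0 u x 1) ^ 2 +
      ((weakDeriv 1 u x 0) ^ 2 + (weakDeriv 1 u x 1) ^ 2)) := by positivity
    linarith [h2 0 0, h2 0 1, h2 1 0, h2 1 1]
  refine h1.trans ?_
  rw [integral_const_mul, integral_add (integrable_norm_sq u) (integrable_finsetSum _ fun j _ =>
      integrable_norm_sq (weakDeriv j u)), integral_finsetSum _ fun j _ =>
      integrable_norm_sq (weakDeriv j u)]
  simp only [integral_norm_sq]
  have h2 : ∑ j, ‖weakDeriv j u‖ ^ 2 = normV u ^ 2 := by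
    rw [normV, Real.sq_sqrt (Finset.sum_nonneg fun _ _ => sq_nonneg _)]
  have h3 : ‖u‖ ^ 2 ≤ normV u ^ 2 := pow_le_pow_left₀ (norm_nonneg u) (norm_le_normV hu) 2
  rw [h2]
  nlinarith

/-! Orthogonality of the advection term and the Stokes operator in two dimensions. -/

/-- The integrand is the divergence of `u_j ∂_j u_i ∂_l u_i - ½ u_l |∂_j u_i|²`, summed over `i, j`,
up to the cubic term `∑ ∂_l u_j ∂_j u_i ∂_l u_i = tr(G² Gᵀ)` with `G = ∇u`. This is where dimension
two matters: a trace-free 2×2 matrix satisfies `G² = -(det G) I`, so the cubic term is `-(det G) tr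
G = 0`. -/
lemma integral_advection_laplacian {U : Fin 2 → Point → ℝ} {D : Fin 2 → Fin 2 → Point → ℝ}
    {E : Fin 2 → Fin 2 → Fin 2 → Point → ℝ} (hU : ∀ i, IsTest (U i)) (hD : ∀ j i, IsTest (D j i))
    (hUD : ∀ j i x, partialDeriv j (U i) x = D j i x)
    (hDE : ∀ l j i x, partialDeriv l (D j i) x = E l j i x)
    (hsymm : ∀ i x, E 1 0 i x = E 0 1 i x) (hdiv : ∀ x, D 0 0 x + D 1 1 x = 0) :
    ∫ x in Ω, ∑ i, (∑ j, U j x * D j i x) * (E 0 0 i x + E 1 1 i x) = 0 := by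
  have hF : ∀ i j l, IsTest fun x =>
      U j x * (D j i x * D l i x) - (1 / 2) * (U l x * (D j i x * D j i x)) := fun i j l =>
    ((hU j).mul ((hD j i).mul (hD l i))).sub
      (((hU l).mul ((hD j i).mul (hD j i))).const_mul (1 / 2))
  have hderiv : ∀ i j l x, partialDeriv l (fun x =>
      U j x * (D j i x * D l i x) - (1 / 2) * (U l x * (D j i x * D j i x))) x
      = D l j x * (D j i x * D l i x) + U j x * (E l j i x * D l i x + D j i x * E l l i x)
        - (1 / 2) * (D l l x * (D j i x * D j i x) +
          U l x * (E l j i x * D j i x + D j i x * E l j i x)) := by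
    intro i j l x
    rw [partialDeriv_sub ((hU j).mul ((hD j i).mul (hD l i)))
      (((hU l).mul ((hD j i).mul (hD j i))).const_mul (1 / 2)),
      partialDeriv_mul (hU j) ((hD j i).mul (hD l i)), partialDeriv_mul (hD j i) (hD l i),
      partialDeriv_const_mul _ ((hU l).mul ((hD j i).mul (hD j i))),
      partialDeriv_mul (hU l) ((hD j i).mul (hD j i)), partialDeriv_mul (hD j i) (hD j i)]
    simp only [hUD, hDE]
  have hpt : ∀ x, ∑ i, (∑ j, U j x * D j i x) * (E 0 0 i x + E 1 1 i x)
      = ∑ i, ∑ j, ∑ l, partialDeriv l (fun x =>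
      U j x * (D j i x * D l i x) - (1 / 2) * (U l x * (D j i x * D j i x))) x := by
    intro x
    simp only [hderiv]
    have h11 : D 1 1 x = - D 0 0 x := by linarith [hdiv x]
    simp only [Fin.sum_univ_two, hsymm, h11]
    ring
  simp only [hpt]
  rw [integral_finsetSum]
  · refine Finset.sum_eq_zero fun i _ => ?_
    rw [integral_finsetSum]
    · refine Finset.sum_eq_zero fun j _ => ?_
      rw [integral_finsetSum]
      · exact Finset.sum_eq_zero fun l _ => integral_partialDeriv_eq_zero (hF i j l) l
      · exact fun l _ => ((hF i j l).continuous_partialDeriv l).continuousOn.integrableOn_compact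
          isCompact_Ω
    · exact fun j _ => (continuous_finsetSum _ fun l _ =>
        (hF i j l).continuous_partialDeriv l).continuousOn.integrableOn_compact isCompact_Ω
  · exact fun i _ => (continuous_finsetSum _ fun j _ => continuous_finsetSum _ fun l _ =>
        (hF i j l).continuous_partialDeriv l).continuousOn.integrableOn_compact isCompact_Ω

lemma trig_add (s : Finset (Fin 2 → ℤ)) (c d : (Fin 2 → ℤ) → ℂ) (x : Point) :
    trig s c x + trig s d x = trig s (fun k => c k + d k) x := by
  simp only [trig, ← Finset.sum_add_distrib, add_mul, Complex.add_re]

lemma integral_trig_advection_laplacian (s : Finset (Fin 2 → ℤ)) (c : Fin 2 → (Fin 2 → ℤ) → ℂ)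
    (hdiv : ∀ k, ∑ j, (k j : ℂ) * c j k = 0) :
    ∫ x in Ω, ∑ i, (∑ j, trig s (c j) x * trig s (fun k => Complex.I * k j * c i k) x) *
      trig s (fun k => (waveLength k : ℂ) ^ 2 * c i k) x = 0 := by
  have h := integral_advection_laplacian (U := fun i => trig s (c i))
    (D := fun j i => trig s fun k => Complex.I * k j * c i k)
    (E := fun l j i => trig s fun k => Complex.I * k l * (Complex.I * k j * c i k))
    (fun i => isTest_trig _ _) (fun j i => isTest_trig _ _)
    (fun j i x => partialDeriv_trig _ _ _ _) (fun l j i x => partialDeriv_trig _ _ _ _)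
    (fun i x => by congr 1; ext k; ring) (fun x => by
      rw [trig_add]
      have : ∀ k : Fin 2 → ℤ, Complex.I * k 0 * c 0 k + Complex.I * k 1 * c 1 k = 0 := fun k => by
        have := hdiv k
        rw [Fin.sum_univ_two] at this
        linear_combination Complex.I * this
      simp [trig, this])
  rw [← neg_eq_zero, ← integral_neg, ← h]
  congr 1
  ext x
  rw [← Finset.sum_neg_distrib]
  refine Finset.sum_congr rfl fun i _ => ?_
  rw [← mul_neg]
  congr 1
  rw [trig_add, trig, trig, ← Finset.sum_neg_distrib]
  refine Finset.sum_congr rfl fun k _ => ?_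
  rw [← Complex.neg_re, ← neg_mul]
  congr 2
  rw [← Complex.ofReal_pow, waveLength_sq, Fin.sum_univ_two]
  push_cast
  linear_combination (-(k 0 : ℂ) ^ 2 * c i k - (k 1 : ℂ) ^ 2 * c i k) * Complex.I_mul_I

lemma exists_ae_abs_le_of_mem_domainA {u : L2} (hu : u ∈ domainA) :
    ∃ M, ∀ᵐ x ∂(volume.restrict Ω), ∀ i, |u x i| ≤ M := by
  obtain ⟨C, _, h⟩ := exists_ae_abs_le_norm_stokes
  exact ⟨_, h u hu⟩

lemma inner_advLp_trunc {u : L2} (hu : u ∈ domainA) (R : ℝ) :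
    inner ℝ (advLp (trunc R u) (trunc R u)) (stokes (trunc R u)) = 0 := by
  obtain ⟨M, hM⟩ := exists_ae_abs_le_of_mem_domainA (trunc_mem_domainA hu R)
  have hst : stokes (trunc R u) = trigLp (modes R)
      fun i k => (waveLength k : ℂ) ^ 2 * fourierCoefficient u k i := by
    rw [stokes_trunc hu, trunc]
    simp only [fourierCoefficient_stokes hu]
  rw [L2.inner_def, ← integral_trig_advection_laplacian (modes R)
    (fun i k => fourierCoefficient u k i) (sum_fourierCoefficient_of_mem_H hu.1)]
  refine integral_congr_ae ?_
  filter_upwards [coeFn_advLp hM (trunc R u), ae_trigLp_apply (modes R)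
    (fun i k => (waveLength k : ℂ) ^ 2 * fourierCoefficient u k i),
    ae_trigLp_apply (modes R) fun i k => fourierCoefficient u k i,
    ae_all_iff.2 fun j : Fin 2 => ae_trigLp_apply (modes R)
      fun i k => Complex.I * k j * fourierCoefficient u k i] with x h1 h2 h3 h4
  rw [h1, hst]
  simp only [PiLp.inner_apply, RCLike.inner_apply, conj_trivial, advection, h2, weakDeriv_trunc,
    h4]
  simp only [trunc, h3]
  exact Finset.sum_congr rfl fun i _ => mul_comm _ _

/-- Bilinearity needs every product to be in `L²`, because `advLp` is zero by default otherwise;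
membership in `D(A)` supplies the pointwise bounds. -/
lemma advLp_sub {u u' : L2} (hu : u ∈ domainA) (hu' : u' ∈ domainA) (hV : u ∈ V) (hV' : u' ∈ V) :
    advLp u u - advLp u' u' = advLp (u - u') u + advLp u' (u - u') := by
  obtain ⟨M, hM⟩ := exists_ae_abs_le_of_mem_domainA hu
  obtain ⟨M', hM'⟩ := exists_ae_abs_le_of_mem_domainA hu'
  obtain ⟨M'', hM''⟩ := exists_ae_abs_le_of_mem_domainA (sub_mem_domainA hu hu')
  ext1
  filter_upwards [Lp.coeFn_sub (advLp u u) (advLp u' u'),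
    Lp.coeFn_add (advLp (u - u') u) (advLp u' (u - u')), coeFn_advLp hM u, coeFn_advLp hM' u',
    coeFn_advLp hM'' u, coeFn_advLp hM' (u - u'), Lp.coeFn_sub u u',
    ae_all_iff.2 fun j => Lp.coeFn_sub (weakDeriv j u) (weakDeriv j u')]
    with x h1 h2 h3 h4 h5 h6 h7 h8
  rw [h1, h2, Pi.sub_apply, Pi.add_apply, h3, h4, h5, h6]
  simp only [advection_eq_sum, weakDeriv_sub hV hV', h7, h8, Pi.sub_apply, PiLp.sub_apply]
  rw [← Finset.sum_sub_distrib, ← Finset.sum_add_distrib]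
  refine Finset.sum_congr rfl fun j _ => ?_
  rw [sub_smul, smul_sub]
  abel

/-- In two dimensions `(B(u, u), A u) = 0`. -/
lemma inner_advLp_stokes {u : L2} (hu : u ∈ domainA) (hV : u ∈ V) :
    inner ℝ (advLp u u) (stokes u) = 0 := by
  obtain ⟨C, hC0, hC⟩ := exists_ae_abs_le_norm_stokes
  -- Truncation commutes with the Stokes operator, so truncations converge in the graph norm. The
  -- advection term is continuous in that norm, and orthogonality passes to the limit.
  have hA : Tendsto (fun N : ℕ => stokes (trunc N u)) atTop (𝓝 (stokes u)) := by
    simp only [stokes_trunc hu]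
    exact tendsto_trunc _
  have hd : Tendsto (fun N : ℕ => ‖stokes (u - trunc N u)‖) atTop (𝓝 0) := by
    have h := (tendsto_iff_norm_sub_tendsto_zero.1 hA)
    refine h.congr fun N => ?_
    rw [stokes_sub hu (trunc_mem_domainA hu N), norm_sub_rev]
  have hadv : Tendsto (fun N : ℕ => advLp (trunc N u) (trunc N u)) atTop (𝓝 (advLp u u)) := by
    rw [tendsto_iff_norm_sub_tendsto_zero]
    have hlim : Tendsto (fun N : ℕ => 2 * (C * ‖stokes (u - trunc N u)‖) * normV u +
        2 * (C * ‖stokes (trunc N u)‖) * ‖stokes (u - trunc N u)‖) atTop (𝓝 0) := by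
      have h1 := ((hd.const_mul C).const_mul 2).mul_const (normV u)
      have h2 := ((hA.norm.const_mul C).const_mul 2).mul hd
      simpa using h1.add h2
    refine squeeze_zero (fun _ => norm_nonneg _) (fun N => ?_) hlim
    have hN := trunc_mem_domainA hu N
    have hNV := trunc_mem_V hu.1 N
    have hs := sub_mem_domainA hu hN
    rw [norm_sub_rev, advLp_sub hu hN hV hNV]
    refine (norm_add_le _ _).trans (add_le_add
      (norm_advLp_le (by positivity) (hC _ hs) _)
      ((norm_advLp_le (by positivity) (hC _ hN) _).trans ?_))
    exact mul_le_mul_of_nonneg_left (normV_le_norm_stokes (sub_mem_V hV hNV) hs) (by positivity)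
  have h := hadv.inner (𝕜 := ℝ) hA
  simp only [inner_advLp_trunc hu] at h
  exact tendsto_nhds_unique h tendsto_const_nhds

/-! Calculus in time. -/

/-- The square of an absolutely continuous real function. -/
lemma sq_sub_sq_eq_integral {a α : ℝ → ℝ} {s t : ℝ} (hs : 0 ≤ s) (hst : s ≤ t)
    (hα : IntervalIntegrable α volume 0 t)
    (ha : ∀ τ ∈ Icc 0 t, a τ = a 0 + ∫ r in (0 : ℝ)..τ, α r) :
    IntervalIntegrable (fun τ => 2 * (a τ * α τ)) volume s t ∧
      a t ^ 2 - a s ^ 2 = ∫ τ in s..t, 2 * (a τ * α τ) := by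
  have h0t : 0 ≤ t := hs.trans hst
  -- `a` is controlled only on `[0, t]`; `b` is the primitive it agrees with there, absolutely
  -- continuous with derivative `α` almost everywhere.
  set b : ℝ → ℝ := fun τ => a 0 + ∫ r in (0 : ℝ)..τ, α r with hb
  have hab : ∀ τ ∈ Icc s t, a τ = b τ := fun τ hτ => ha τ ⟨hs.trans hτ.1, hτ.2⟩
  have hac0 : AbsolutelyContinuousOnInterval b 0 t := by
    have h1 := hα.absolutelyContinuousOnInterval_intervalIntegral (c := 0) (by simp)
    have h2 : AbsolutelyContinuousOnInterval (fun _ : ℝ => a 0) 0 t :=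
      contDiffOn_const.absolutelyContinuousOnInterval
    exact h2.add h1
  have hac : AbsolutelyContinuousOnInterval b s t := hac0.mono (by
    rw [uIcc_of_le hst, uIcc_of_le h0t]; exact Icc_subset_Icc_left hs)
  have hαst : IntervalIntegrable α volume s t := hα.mono_set (by
    rw [uIcc_of_le hst, uIcc_of_le h0t]; exact Icc_subset_Icc_left hs)
  have hderiv : ∀ᵐ τ, τ ∈ uIoc s t → deriv b τ = α τ := by
    filter_upwards [hα.ae_hasDerivAt_integral] with τ hτ hmem
    rw [uIoc_of_le hst] at hmem
    have := hτ (by rw [uIcc_of_le h0t]; exact ⟨hs.trans hmem.1.le, hmem.2⟩) 0 (by simp)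
    exact (this.const_add (a 0)).deriv
  have hbcont : ContinuousOn b (uIcc s t) := hac.continuousOn
  have key := hac.integral_deriv_mul_eq_sub hac
  have hcongr : ∀ᵐ τ, τ ∈ uIoc s t → deriv b τ * b τ + b τ * deriv b τ = 2 * (a τ * α τ) := by
    filter_upwards [hderiv] with τ hτ hmem
    have hm : τ ∈ Icc s t := by rw [uIoc_of_le hst] at hmem; exact ⟨hmem.1.le, hmem.2⟩
    rw [hτ hmem, hab τ hm]
    ring
  constructor
  · have h1 : IntervalIntegrable (fun τ => 2 * (b τ * α τ)) volume s t :=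
      (hαst.continuousOn_mul hbcont).const_mul 2
    refine h1.congr fun τ hmem => ?_
    have hm : τ ∈ Icc s t := by rw [uIoc_of_le hst] at hmem; exact ⟨hmem.1.le, hmem.2⟩
    simp only [hab τ hm]
  · rw [intervalIntegral.integral_congr_ae hcongr] at key
    rw [key, hab t ⟨hst, le_rfl⟩, hab s ⟨le_rfl, hst⟩]
    ring

/-- An integral differential inequality `y' ≤ a - b y` bounds `y` eventually by `a / b + ε`. -/
lemma eventually_le_of_integral_le {y : ℝ → ℝ} {a b T : ℝ} (hb : 0 < b)
    (hy : ContinuousOn y (Ici T))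
    (h : ∀ s t, T ≤ s → s ≤ t → y t - y s ≤ ∫ τ in s..t, (a - b * y τ)) {ε : ℝ} (hε : 0 < ε) :
    ∀ᶠ t in atTop, y t ≤ a / b + ε := by
  have hbound : ∀ t, T ≤ t → y t ≤ gronwallBound (y T) (-b) a (t - T) := by
    intro t ht
    refine le_gronwallBound_of_liminf_deriv_right_le (f := y) (f' := fun x => a - b * y x)
      (a := T) (b := t) (hy.mono Icc_subset_Ici_self) ?_ le_rfl (fun x _ => by linarith) t
      ⟨ht, le_rfl⟩
    intro x hx r hr
    have hcont : ContinuousOn (fun τ => a - b * y τ) (Ici x) :=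
      (continuousOn_const.sub (continuousOn_const.mul hy)).mono (Ici_subset_Ici.2 hx.1)
    have hev : ∀ᶠ τ in 𝓝[≥] x, a - b * y τ < r :=
      (hcont x self_mem_Ici).eventually (gt_mem_nhds hr)
    obtain ⟨u, hxu, hu⟩ := mem_nhdsGE_iff_exists_Ico_subset.1 hev
    have hev2 : ∀ᶠ z in 𝓝[>] x, (z - x)⁻¹ * (y z - y x) < r := by
      filter_upwards [Ioo_mem_nhdsGT hxu] with z hz
      have hzx : 0 < z - x := sub_pos.2 hz.1
      have h1 := h x z hx.1 hz.1.le
      have hicc : Icc x z ⊆ Ici x := Icc_subset_Ici_self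
      -- The integrand is below `r` near `x`, and its maximum over `[x, z]` is attained; this makes
      -- the difference quotient strictly smaller than `r`, as the Dini form of Gronwall's
      -- inequality requires.
      obtain ⟨m, hm, hmax⟩ := isCompact_Icc.exists_isMaxOn (nonempty_Icc.2 hz.1.le)
        (hcont.mono hicc)
      have hmr : a - b * y m < r := hu ⟨hm.1, hm.2.trans_lt hz.2⟩
      have h2 : ∫ τ in x..z, (a - b * y τ) ≤ ∫ _ in x..z, (a - b * y m) := by
        refine intervalIntegral.integral_mono_on hz.1.le ?_ intervalIntegrable_const
          fun τ hτ => hmax hτ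
        exact (hcont.mono (by rw [uIcc_of_le hz.1.le]; exact hicc)).intervalIntegrable
      rw [intervalIntegral.integral_const, smul_eq_mul] at h2
      rw [inv_mul_lt_iff₀ hzx]
      nlinarith
    exact hev2.frequently
  have hlim : Tendsto (fun t => gronwallBound (y T) (-b) a (t - T)) atTop (𝓝 (a / b)) := by
    rw [gronwallBound_of_K_ne_0 (neg_ne_zero.2 hb.ne')]
    have h1 : Tendsto (fun t => Real.exp (-b * (t - T))) atTop (𝓝 0) := by
      refine Real.tendsto_exp_atBot.comp ?_
      exact (tendsto_atTop_add_const_right _ _ tendsto_id).const_mul_atTop_of_neg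
        (neg_lt_zero.2 hb)
    have h2 := (h1.const_mul (y T)).add ((h1.sub_const 1).const_mul (a / -b))
    have h3 : y T * 0 + a / -b * (0 - 1) = a / b := by
      rw [div_neg]; ring
    rwa [h3] at h2
  filter_upwards [hlim.eventually (gt_mem_nhds (lt_add_of_pos_right _ hε)),
    eventually_ge_atTop T] with t h1 h2
  exact (hbound t h2).trans h1.le

/-! The energy identity in `V`. -/

lemma sq_clm_sub_sq_eq_integral {u f : ℝ → L2} {s t : ℝ} (hs : 0 ≤ s) (hst : s ≤ t)
    (hf : IntervalIntegrable f volume 0 t)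
    (hu : ∀ τ ∈ Icc 0 t, u τ = u 0 + ∫ r in (0 : ℝ)..τ, f r) (L : L2 →L[ℝ] ℝ) :
    IntervalIntegrable (fun τ => 2 * (L (u τ) * L (f τ))) volume s t ∧
      L (u t) ^ 2 - L (u s) ^ 2 = ∫ τ in s..t, 2 * (L (u τ) * L (f τ)) := by
  refine sq_sub_sq_eq_integral (a := fun τ => L (u τ)) (α := fun τ => L (f τ)) hs hst
    ⟨L.integrable_comp hf.1, L.integrable_comp hf.2⟩ fun τ hτ => ?_
  rw [L.intervalIntegral_comp_comm, ← map_add, ← hu τ hτ]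
  exact hf.mono_set (by
    rw [uIcc_of_le hτ.1, uIcc_of_le (hs.trans hst)]; exact Icc_subset_Icc_right hτ.2)

lemma fourierCoefficient_energy {u f : ℝ → L2} {s t : ℝ} (hs : 0 ≤ s) (hst : s ≤ t)
    (hf : IntervalIntegrable f volume 0 t)
    (hu : ∀ τ ∈ Icc 0 t, u τ = u 0 + ∫ r in (0 : ℝ)..τ, f r) (k : Fin 2 → ℤ) (i : Fin 2) :
    IntervalIntegrable (fun τ => 2 * (fourierCoefficient (u τ) k i *
        conj (fourierCoefficient (f τ) k i)).re) volume s t ∧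
      ‖fourierCoefficient (u t) k i‖ ^ 2 - ‖fourierCoefficient (u s) k i‖ ^ 2
        = ∫ τ in s..t, 2 * (fourierCoefficient (u τ) k i *
          conj (fourierCoefficient (f τ) k i)).re := by
  obtain ⟨h1, h2⟩ := sq_clm_sub_sq_eq_integral hs hst hf hu (Complex.reCLM.comp (fourierCLM k i))
  obtain ⟨h3, h4⟩ := sq_clm_sub_sq_eq_integral hs hst hf hu (Complex.imCLM.comp (fourierCLM k i))
  have h5 : ∀ τ, 2 * (fourierCoefficient (u τ) k i * conj (fourierCoefficient (f τ) k i)).re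
      = 2 * (Complex.reCLM.comp (fourierCLM k i) (u τ) * Complex.reCLM.comp (fourierCLM k i) (f τ))
      + 2 * (Complex.imCLM.comp (fourierCLM k i) (u τ) *
          Complex.imCLM.comp (fourierCLM k i) (f τ)) := by
    intro τ
    simp only [ContinuousLinearMap.comp_apply, fourierCLM_apply, Complex.reCLM_apply,
      Complex.imCLM_apply, Complex.mul_re, Complex.conj_re, Complex.conj_im]
    ring
  simp only [h5]
  refine ⟨h1.add h3, ?_⟩
  rw [intervalIntegral.integral_add h1 h3, ← h2, ← h4]
  simp only [ContinuousLinearMap.comp_apply, fourierCLM_apply, Complex.reCLM_apply,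
    Complex.imCLM_apply, ← Complex.normSq_eq_norm_sq, Complex.normSq_apply]
  ring

/-- The bound is uniform in the set of modes and so provides the dominating function for the limit
in `normV_energy`. -/
lemma abs_sum_fourier_le (s : Finset (Fin 2 → ℤ)) (w z : L2) :
    |∑ k ∈ s, (2 * π) ^ 2 * ∑ i, 2 * (fourierCoefficient w k i *
      conj (fourierCoefficient z k i)).re| ≤ ‖w‖ ^ 2 + ‖z‖ ^ 2 := by
  refine (Finset.abs_sum_le_sum_abs _ _).trans ?_
  refine le_trans ?_ (sum_le_hasSum s (fun k _ => by positivity)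
    ((hasSum_norm_sq w).add (hasSum_norm_sq z)))
  refine Finset.sum_le_sum fun k _ => ?_
  rw [abs_mul, abs_of_pos two_pi_sq_pos, ← mul_add, ← Finset.sum_add_distrib]
  refine mul_le_mul_of_nonneg_left ?_ two_pi_sq_pos.le
  refine (Finset.abs_sum_le_sum_abs _ _).trans (Finset.sum_le_sum fun i _ => ?_)
  rw [abs_mul, abs_two]
  have h := Complex.abs_re_le_norm (fourierCoefficient w k i * conj (fourierCoefficient z k i))
  rw [norm_mul, RCLike.norm_conj] at h
  nlinarith [sq_nonneg (‖fourierCoefficient w k i‖ - ‖fourierCoefficient z k i‖)]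

lemma intervalIntegrable_finsetSum {ι : Type*} (S : Finset ι) {F : ι → ℝ → ℝ} {s t : ℝ}
    (h : ∀ i ∈ S, IntervalIntegrable (F i) volume s t) :
    IntervalIntegrable (fun τ => ∑ i ∈ S, F i τ) volume s t :=
  ⟨integrable_finsetSum S fun i hi => (h i hi).1, integrable_finsetSum S fun i hi => (h i hi).2⟩

/-- Each coefficient is absolutely continuous in time and has its own energy identity. These are
weighted by `|k|²`, summed over `|k| ≤ N`, and passed to the limit by dominated convergence. No
chain rule for `V`-valued functions is needed, only `Au` and `f` in `L²` in time. -/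
lemma normV_energy {u f : ℝ → L2} {s t : ℝ} (hs : 0 ≤ s) (hst : s ≤ t)
    (hf : IntervalIntegrable f volume 0 t)
    (hu : ∀ τ ∈ Icc 0 t, u τ = u 0 + ∫ r in (0 : ℝ)..τ, f r) (hV : ∀ τ, 0 ≤ τ → u τ ∈ V)
    (hA : ∀ᵐ τ ∂(volume.restrict (Ioi (0 : ℝ))), u τ ∈ domainA)
    (hA2 : MemLp (fun τ => stokes (u τ)) 2 (volume.restrict (Ioo 0 t)))
    (hf2 : MemLp f 2 (volume.restrict (Ioo 0 t))) :
    IntervalIntegrable (fun τ => 2 * inner ℝ (stokes (u τ)) (f τ)) volume s t ∧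
      normV (u t) ^ 2 - normV (u s) ^ 2 = ∫ τ in s..t, 2 * inner ℝ (stokes (u τ)) (f τ) := by
  have hsub : Ioo s t ⊆ Ioo 0 t := Ioo_subset_Ioo_left hs
  have hAst := hA2.mono_measure (Measure.restrict_mono hsub le_rfl)
  have hfst := hf2.mono_measure (Measure.restrict_mono hsub le_rfl)
  have hII : ∀ {F : ℝ → ℝ}, Integrable F (volume.restrict (Ioo s t)) →
      IntervalIntegrable F volume s t := fun {F} hF =>
    (intervalIntegrable_iff_integrableOn_Ioo_of_le hst).2 hF
  have hint : IntervalIntegrable (fun τ => 2 * inner ℝ (stokes (u τ)) (f τ)) volume s t := by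
    refine hII ?_
    refine Integrable.const_mul ?_ 2
    refine Integrable.mono' ((hAst.integrable_norm_pow (p := 2) (by norm_num)).add
      (hfst.integrable_norm_pow (p := 2) (by norm_num))) (hAst.1.inner hfst.1) ?_
    refine Eventually.of_forall fun τ => ?_
    refine (norm_inner_le_norm _ _).trans ?_
    simp only [Pi.add_apply]
    nlinarith [sq_nonneg (‖stokes (u τ)‖ - ‖f τ‖), sq_nonneg ‖stokes (u τ)‖, sq_nonneg ‖f τ‖]
  refine ⟨hint, ?_⟩
  set F : ℕ → ℝ → ℝ := fun N τ => ∑ k ∈ modes N, (2 * π) ^ 2 * (waveLength k ^ 2 * ∑ i,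
    2 * (fourierCoefficient (u τ) k i * conj (fourierCoefficient (f τ) k i)).re) with hFdef
  set Y : ℕ → ℝ → ℝ := fun N τ => ∑ k ∈ modes N, (2 * π) ^ 2 * (waveLength k ^ 2 * ∑ i,
    ‖fourierCoefficient (u τ) k i‖ ^ 2) with hYdef
  have hmode := fun k i => fourierCoefficient_energy hs hst hf hu k i
  have hkint : ∀ k, IntervalIntegrable (fun τ => (2 * π) ^ 2 * (waveLength k ^ 2 * ∑ i,
      2 * (fourierCoefficient (u τ) k i * conj (fourierCoefficient (f τ) k i)).re)) volume s t :=
    fun k => ((intervalIntegrable_finsetSum _ fun i _ => (hmode k i).1).const_mul _).const_mul _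
  have hFint : ∀ N, IntervalIntegrable (F N) volume s t := fun N =>
    intervalIntegrable_finsetSum _ fun k _ => hkint k
  have hYF : ∀ N, Y N t - Y N s = ∫ τ in s..t, F N τ := by
    intro N
    simp only [hFdef, hYdef]
    rw [intervalIntegral.integral_finsetSum fun k _ => hkint k, ← Finset.sum_sub_distrib]
    refine Finset.sum_congr rfl fun k _ => ?_
    rw [intervalIntegral.integral_const_mul, intervalIntegral.integral_const_mul,
      intervalIntegral.integral_finsetSum fun i _ => (hmode k i).1, ← mul_sub, ← mul_sub,
      ← Finset.sum_sub_distrib]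
    congr 2
    exact Finset.sum_congr rfl fun i _ => (hmode k i).2
  have hAst' : ∀ᵐ τ, τ ∈ uIoc s t → u τ ∈ domainA := by
    rw [ae_restrict_iff' measurableSet_Ioi] at hA
    filter_upwards [hA] with τ hτ hm
    rw [uIoc_of_le hst] at hm
    exact hτ (hs.trans_lt hm.1)
  -- The weight `|k|²` is moved onto `u`, turning the partial sums of `F` into Parseval sums for
  -- `2(Au, f)`.
  have hFA : ∀ τ, u τ ∈ domainA → ∀ k, (2 * π) ^ 2 * (waveLength k ^ 2 * ∑ i,
      2 * (fourierCoefficient (u τ) k i * conj (fourierCoefficient (f τ) k i)).re)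
      = (2 * π) ^ 2 * ∑ i, 2 * (fourierCoefficient (stokes (u τ)) k i *
        conj (fourierCoefficient (f τ) k i)).re := by
    intro τ hτ k
    rw [Finset.mul_sum]
    congr 1
    refine Finset.sum_congr rfl fun i _ => ?_
    rw [fourierCoefficient_stokes hτ, mul_assoc, ← Complex.ofReal_pow, Complex.re_ofReal_mul]
    ring
  have hlimF : Tendsto (fun N => ∫ τ in s..t, F N τ) atTop
      (𝓝 (∫ τ in s..t, 2 * inner ℝ (stokes (u τ)) (f τ))) := by
    refine intervalIntegral.tendsto_integral_filter_of_dominated_convergence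
      (fun τ => ‖stokes (u τ)‖ ^ 2 + ‖f τ‖ ^ 2)
      (Eventually.of_forall fun N => ?_) (Eventually.of_forall fun N => ?_) ?_ ?_
    · rw [uIoc_of_le hst]
      exact (hFint N).aestronglyMeasurable
    · filter_upwards [hAst'] with τ hτ hm
      simp only [hFdef, hFA τ (hτ hm), Real.norm_eq_abs]
      exact abs_sum_fourier_le _ _ _
    · exact hII ((hAst.integrable_norm_pow (p := 2) (by norm_num)).add
        (hfst.integrable_norm_pow (p := 2) (by norm_num)))
    · filter_upwards [hAst'] with τ hτ hm
      simp only [hFdef, hFA τ (hτ hm)]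
      have h := ((hasSum_inner (stokes (u τ)) (f τ)).mul_left 2).comp tendsto_modes
      refine Tendsto.congr (fun N => ?_) h
      refine Finset.sum_congr rfl fun k _ => ?_
      rw [← Finset.mul_sum]
      ring
  have hlimY : ∀ τ, 0 ≤ τ → Tendsto (fun N => Y N τ) atTop (𝓝 (normV (u τ) ^ 2)) :=
    fun τ hτ => (hasSum_normV_sq (hV τ hτ)).comp tendsto_modes
  have hl := (hlimY t (hs.trans hst)).sub (hlimY s hs)
  simp only [hYF] at hl
  exact tendsto_nhds_unique hl hlimF

/-! Estimates for the system. -/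

lemma lowModes_eq_trunc (K : ℝ) (u : L2) : lowModes K u = trunc K u := by
  refine eq_of_fourierCoefficient_eq fun k i => ?_
  rw [fourierCoefficient_lowModes, fourierCoefficient_trunc]
  simp only [mem_modes]

lemma inner_trunc (R : ℝ) (u w : L2) : inner ℝ (trunc R u) w = inner ℝ u (trunc R w) := by
  refine (hasSum_inner (trunc R u) w).unique ((hasSum_inner u (trunc R w)).congr_fun fun k => ?_)
  simp only [fourierCoefficient_trunc]
  split_ifs <;> simp

lemma norm_trunc_le (R : ℝ) (u : L2) : ‖trunc R u‖ ≤ ‖u‖ := by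
  refine le_of_sq_le_sq ?_ (norm_nonneg _)
  refine hasSum_le (fun k => ?_) (hasSum_norm_sq (trunc R u)) (hasSum_norm_sq u)
  simp only [fourierCoefficient_trunc]
  split_ifs
  · exact le_rfl
  · simp only [norm_zero, ne_eq, OfNat.ofNat_ne_zero, not_false_eq_true, zero_pow,
      Finset.sum_const_zero, mul_zero]
    positivity

lemma inner_stokes_B {u : L2} (hu : u ∈ domainA) (hV : u ∈ V) :
    inner ℝ (stokes u) (B u u) = 0 := by
  rw [B_eq_leray, real_inner_comm, inner_leray _ (stokes_mem_H hu), inner_advLp_stokes hu hV]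

/-- The size of the low modes of `A δ`, which bounds `P_K A δ` pointwise. -/
def lowModeSize (K : ℝ) (δ : L2) : ℝ :=
  ∑ i, ∑ k ∈ modes K, waveLength k ^ 2 * ‖fourierCoefficient δ k i‖

lemma lowModeSize_nonneg (K : ℝ) (δ : L2) : 0 ≤ lowModeSize K δ :=
  Finset.sum_nonneg fun _ _ => Finset.sum_nonneg fun _ _ => by positivity

lemma ae_abs_trunc_stokes_le (K : ℝ) {δ : L2} (hδ : δ ∈ domainA) :
    ∀ᵐ x ∂(volume.restrict Ω), ∀ i, |trunc K (stokes δ) x i| ≤ lowModeSize K δ := by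
  filter_upwards [ae_trigLp_apply (modes K) fun i k => fourierCoefficient (stokes δ) k i]
    with x hx i
  rw [trunc, hx]
  refine (abs_trig_le _ _ _).trans ?_
  have h : ∀ k, ‖fourierCoefficient (stokes δ) k i‖
      = waveLength k ^ 2 * ‖fourierCoefficient δ k i‖ := fun k => by
    rw [fourierCoefficient_stokes hδ, norm_mul, norm_pow, Complex.norm_real,
      Real.norm_of_nonneg (waveLength_nonneg k)]
  simp only [h]
  exact Finset.single_le_sum (f := fun i => ∑ k ∈ modes K,
    waveLength k ^ 2 * ‖fourierCoefficient δ k i‖)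
    (fun i _ => Finset.sum_nonneg fun k _ => by positivity) (Finset.mem_univ i)

lemma abs_inner_B_le {u δ : L2} (K : ℝ) (hu : u ∈ domainA) (hV : u ∈ V) (hδ : δ ∈ domainA) :
    |inner ℝ (B u u) (trunc K (stokes δ))| ≤ 2 * lowModeSize K δ * normV u ^ 2 := by
  obtain ⟨M, hM⟩ := exists_ae_abs_le_of_mem_domainA hu
  rw [B_eq_leray, inner_leray _ (trunc_mem_H (stokes_mem_H hδ) K)]
  exact abs_inner_advLp_le hV hM (lowModeSize_nonneg K δ) (ae_abs_trunc_stokes_le K hδ)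

/-- Since `‖u‖` is locally bounded and `|Au|` is square-integrable in time along a solution, this
places `B(u,u)` in `L²(0,T;H)`, hence also the time derivative, as the energy identity demands. -/
lemma exists_norm_B_le :
    ∃ C : ℝ, 0 ≤ C ∧ ∀ u ∈ domainA, ‖B u u‖ ≤ C * ‖stokes u‖ * normV u := by
  obtain ⟨C, hC0, hC⟩ := exists_ae_abs_le_norm_stokes
  refine ⟨2 * C, by positivity, fun u hu => ?_⟩
  rw [B_eq_leray]
  refine (norm_leray_le _).trans ((norm_advLp_le (by positivity) (hC u hu) u).trans (le_of_eq ?_))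
  ring

/-! ### Synchronization of the low modes and the energy estimate for solutions. -/

section Solution

variable {ν K : ℝ} {M : Matrix (Fin 2) (Fin 2) ℝ} {g v : Fin 2 → ℝ → L2}

lemma IsForce.ae_norm_le (hg : IsForce g) (j : Fin 2) :
    ∀ᵐ t ∂(volume.restrict (Ioi (0 : ℝ))),
      ‖g j t‖ ≤ (eLpNorm (g j) ∞ (volume.restrict (Ioi 0))).toReal := by
  have h := ae_le_eLpNormEssSup (f := g j) (μ := volume.restrict (Ioi (0 : ℝ)))
  filter_upwards [h] with t ht
  rw [← toReal_enorm]
  refine ENNReal.toReal_mono (hg j).1.2.ne ?_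
  rwa [eLpNorm_exponent_top]

lemma IsSynchronousPair.ae_le (hs : IsSynchronousPair g) {ε : ℝ} (hε : 0 < ε) :
    ∃ T, 0 ≤ T ∧ ∀ᵐ t, T ≤ t → ‖g 0 t - g 1 t‖ ≤ ε := by
  have h := hs.eventually (gt_mem_nhds hε)
  obtain ⟨s, hs, t, ht, hst⟩ := mem_inf_iff_superset.1 h
  obtain ⟨T, hT⟩ := mem_atTop_sets.1 hs
  refine ⟨max T 0, le_max_right _ _, ?_⟩
  filter_upwards [ht] with τ hτ hle
  exact le_of_lt (hst ⟨hT τ ((le_max_left _ _).trans hle), hτ⟩)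

lemma IsSolution.continuousOn_normV (hv : IsSolution ν K M g v) (i : Fin 2) :
    ContinuousOn (fun t => normV (v i t)) (Ici 0) := by
  intro t₀ ht₀
  rw [ContinuousWithinAt, tendsto_iff_dist_tendsto_zero]
  refine squeeze_zero' (Eventually.of_forall fun _ => dist_nonneg) ?_ (hv.continuous_V i t₀ ht₀)
  filter_upwards [self_mem_nhdsWithin] with t ht
  exact abs_normV_sub_le (hv.mem_V i t ht) (hv.mem_V i t₀ ht₀)

lemma IsSolution.continuousOn (hv : IsSolution ν K M g v) (i : Fin 2) :
    ContinuousOn (v i) (Ici 0) := by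
  intro t₀ ht₀
  rw [ContinuousWithinAt, tendsto_iff_norm_sub_tendsto_zero]
  refine squeeze_zero' (Eventually.of_forall fun _ => norm_nonneg _) ?_ (hv.continuous_V i t₀ ht₀)
  filter_upwards [self_mem_nhdsWithin] with t ht
  exact norm_le_normV (sub_mem_V (hv.mem_V i t ht) (hv.mem_V i t₀ ht₀))

lemma norm_lowModes_le (u : L2) : ‖lowModes K u‖ ≤ ‖u‖ := by
  rw [lowModes_eq_trunc]
  exact norm_trunc_le K u

lemma norm_vectorField_le (hν : 0 < ν) {i : Fin 2} {t G : ℝ} {b : Fin 2 → ℝ}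
    (hG : ‖g i t‖ ≤ G) (hB : ∀ j, ‖B (v j t) (v j t)‖ ≤ b j) :
    ‖vectorField ν K M g v i t‖ ≤ G + ν * ‖stokes (v i t)‖ + b i + ∑ j, |M i j| * b j := by
  have h1 : ‖∑ j, M i j • lowModes K (B (v j t) (v j t))‖ ≤ ∑ j, |M i j| * b j := by
    refine (norm_sum_le _ _).trans (Finset.sum_le_sum fun j _ => ?_)
    rw [norm_smul, Real.norm_eq_abs]
    exact mul_le_mul_of_nonneg_left ((norm_lowModes_le _).trans (hB j)) (abs_nonneg _)
  have h2 : ‖ν • stokes (v i t)‖ = ν * ‖stokes (v i t)‖ := by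
    rw [norm_smul, Real.norm_of_nonneg hν.le]
  have h3 := norm_sub_le (g i t) (ν • stokes (v i t))
  have h4 := norm_sub_le (g i t - ν • stokes (v i t)) (B (v i t) (v i t))
  have h5 := norm_add_le (g i t - ν • stokes (v i t) - B (v i t) (v i t))
    (∑ j, M i j • lowModes K (B (v j t) (v j t)))
  rw [vectorField]
  linarith [hB i]

lemma IsSolution.memLp_vectorField (hν : 0 < ν) (hg : IsForce g) (hv : IsSolution ν K M g v)
    (i : Fin 2) {T : ℝ} (hT : 0 < T) :
    MemLp (vectorField ν K M g v i) 2 (volume.restrict (Ioo 0 T)) := by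
  obtain ⟨C, hC0, hC⟩ := exists_norm_B_le
  have hbd : ∀ j, ∃ Y, ∀ t ∈ Icc 0 T, normV (v j t) ≤ Y := fun j => by
    obtain ⟨Y, hY⟩ := isCompact_Icc.exists_bound_of_continuousOn
      ((hv.continuousOn_normV j).mono (show Icc 0 T ⊆ Ici 0 from fun t ht => ht.1))
    exact ⟨Y, fun t ht => (le_abs_self _).trans (hY t ht)⟩
  choose Y hY using hbd
  have hsub : Ioo 0 T ⊆ Ioi 0 := Ioo_subset_Ioi_self
  have hS : ∀ j, MemLp (fun t => ‖stokes (v j t)‖) 2 (volume.restrict (Ioo 0 T)) :=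
    fun j => (hv.stokes_memLp j T hT).norm
  have hconst : MemLp (fun _ : ℝ => (eLpNorm (g i) ∞ (volume.restrict (Ioi 0))).toReal) 2
      (volume.restrict (Ioo 0 T)) := memLp_const _
  have hsum : MemLp (fun t => ∑ j, |M i j| * (C * Y j * ‖stokes (v j t)‖)) 2
      (volume.restrict (Ioo 0 T)) :=
    memLp_finsetSum _ fun j _ => ((hS j).const_mul (C * Y j)).const_mul |M i j|
  have hdom := ((hconst.add ((hS i).const_mul ν)).add ((hS i).const_mul (C * Y i))).add hsum
  refine hdom.mono' ?_ ?_
  · have := (hv.integrable i T hT.le).aestronglyMeasurable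
    exact this.mono_measure (Measure.restrict_mono Ioo_subset_Ioc_self le_rfl)
  · have hAE := fun j => ae_restrict_of_ae_restrict_of_subset hsub (hv.mem_domainA j)
    filter_upwards [ae_restrict_of_ae_restrict_of_subset hsub (hg.ae_norm_le i),
      ae_all_iff.2 hAE, ae_restrict_mem measurableSet_Ioo] with t hgt hA ht
    have hB : ∀ j, ‖B (v j t) (v j t)‖ ≤ C * Y j * ‖stokes (v j t)‖ := fun j => by
      refine (hC _ (hA j)).trans ?_
      rw [mul_right_comm]
      exact mul_le_mul_of_nonneg_right (mul_le_mul_of_nonneg_left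
        (hY j t (Ioo_subset_Icc_self ht)) hC0) (norm_nonneg _)
    exact norm_vectorField_le hν hgt hB

/-- On the modes `|k| ≤ K` the difference of the two components solves a linear heat equation. -/
lemma fourierCoefficient_vectorField_sub {k : Fin 2 → ℤ} (hk : waveLength k ≤ K) {t : ℝ}
    (hA : ∀ j, v j t ∈ domainA) (i : Fin 2) :
    fourierCoefficient (vectorField ν K (symMatrix (1 / 2) (1 / 2)) g v 0 t -
        vectorField ν K (symMatrix (1 / 2) (1 / 2)) g v 1 t) k i
      = fourierCoefficient (g 0 t - g 1 t) k i -
        ((ν * waveLength k ^ 2 : ℝ) : ℂ) * fourierCoefficient (v 0 t - v 1 t) k i := by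
  -- On a low mode `B(v₁,v₁)` carries the coefficient `-1 + ½ + ½` and `B(v₂,v₂)` the opposite one,
  -- so both vanish.
  simp only [vectorField, symMatrix, Fin.sum_univ_two, fourierCoefficient_sub,
    fourierCoefficient_add, fourierCoefficient_smul, fourierCoefficient_lowModes, if_pos hk,
    fourierCoefficient_stokes (hA 0), fourierCoefficient_stokes (hA 1), Matrix.of_apply,
    Matrix.cons_val', Matrix.cons_val_zero, Matrix.cons_val_one, Matrix.cons_val_fin_one]
  push_cast
  ring

lemma two_mul_re_mul_conj_le {a r : ℂ} {l : ℝ} (hl : 0 < l) :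
    2 * (a * conj (r - l * a)).re ≤ ‖r‖ ^ 2 / l - l * ‖a‖ ^ 2 := by
  have h1 : (a * conj (r - l * a)).re = (a * conj r).re - l * ‖a‖ ^ 2 := by
    rw [map_sub, mul_sub, Complex.sub_re, map_mul, Complex.conj_ofReal, mul_left_comm,
      Complex.re_ofReal_mul, Complex.mul_conj, Complex.ofReal_re, Complex.normSq_eq_norm_sq]
  have h2 := Complex.re_le_norm (a * conj r)
  rw [norm_mul, RCLike.norm_conj] at h2
  have h3 : 2 * (‖a‖ * ‖r‖) ≤ ‖r‖ ^ 2 / l + l * ‖a‖ ^ 2 := by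
    have h4 : ‖r‖ ^ 2 / l + l * ‖a‖ ^ 2 - 2 * (‖a‖ * ‖r‖) = (‖r‖ - l * ‖a‖) ^ 2 / l := by
      field_simp
      ring
    have h5 : 0 ≤ (‖r‖ - l * ‖a‖) ^ 2 / l := by positivity
    linarith
  rw [h1]
  linarith

/-- The squared modulus `y` of a low coefficient of `δ` satisfies `y' ≤ |g₁ - g₂|²/l - l y` with `l
= ν|k|²`, and the forcing is eventually arbitrarily small. The zero mode has no damping but vanishes
because fields in `H` are mean-free. -/
lemma IsSolution.tendsto_fourierCoefficient_sub (hν : 0 < ν) (hs : IsSynchronousPair g)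
    (hv : IsSolution ν K (symMatrix (1 / 2) (1 / 2)) g v) {k : Fin 2 → ℤ}
    (hk : waveLength k ≤ K) (i : Fin 2) :
    Tendsto (fun t => ‖fourierCoefficient (v 0 t - v 1 t) k i‖) atTop (𝓝 0) := by
  by_cases hk0 : k = 0
  · subst hk0
    refine (tendsto_congr' ?_).2 tendsto_const_nhds
    filter_upwards [eventually_ge_atTop 0] with t ht
    rw [fourierCoefficient_zero_of_mem_H
      (H.sub_mem (hv.mem_V 0 t ht).1 (hv.mem_V 1 t ht).1), norm_zero]
  set l : ℝ := ν * waveLength k ^ 2 with hl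
  have hl0 : 0 < l := by have := one_le_waveLength hk0; positivity
  set f : ℝ → L2 := fun t => vectorField ν K (symMatrix (1 / 2) (1 / 2)) g v 0 t -
    vectorField ν K (symMatrix (1 / 2) (1 / 2)) g v 1 t with hf
  have hfint : ∀ t, 0 ≤ t → IntervalIntegrable f volume 0 t := fun t ht =>
    (hv.integrable 0 t ht).sub (hv.integrable 1 t ht)
  have heq : ∀ t, 0 ≤ t → v 0 t - v 1 t = (v 0 0 - v 1 0) + ∫ r in (0 : ℝ)..t, f r := by
    intro t ht
    rw [intervalIntegral.integral_sub (hv.integrable 0 t ht) (hv.integrable 1 t ht)]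
    nth_rw 1 [hv.equation 0 t ht, hv.equation 1 t ht]
    abel
  have hcont : ContinuousOn (fun t => ‖fourierCoefficient (v 0 t - v 1 t) k i‖ ^ 2) (Ici 0) :=
    (((fourierCLM k i).continuous.comp_continuousOn
      ((hv.continuousOn 0).sub (hv.continuousOn 1))).norm).pow 2
  have hsq : Tendsto (fun t => ‖fourierCoefficient (v 0 t - v 1 t) k i‖ ^ 2) atTop (𝓝 0) := by
    rw [Metric.tendsto_atTop']
    intro ε hε
    -- Chosen so that the asymptotic level `(η²/l)/l` equals `ε/4`; with the slack `ε/4` this stays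
    -- below `ε`.
    set η : ℝ := √(ε / 4) * l with hη
    have hη0 : 0 < η := by positivity
    obtain ⟨T, hT0, hT⟩ := hs.ae_le hη0
    have hev := eventually_le_of_integral_le (a := η ^ 2 / l) hl0
      (hcont.mono (Ici_subset_Ici.2 hT0)) (fun s t hTs hst => ?_) (ε := ε / 4) (by positivity)
    · obtain ⟨N, hN⟩ := eventually_atTop.1 hev
      refine ⟨N, fun t ht => ?_⟩
      rw [Real.dist_eq, sub_zero, abs_of_nonneg (by positivity)]
      have h1 := hN t ht.le
      have h2 : η ^ 2 / l / l = ε / 4 := by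
        rw [hη, mul_pow, Real.sq_sqrt (by positivity)]
        field_simp
      linarith
    · have h0s := hT0.trans hTs
      obtain ⟨h1, h2⟩ := fourierCoefficient_energy (u := fun t => v 0 t - v 1 t) h0s hst
        (hfint t (h0s.trans hst)) (fun τ hτ => heq τ hτ.1) k i
      rw [h2]
      refine intervalIntegral.integral_mono_ae_restrict hst h1 ?_ ?_
      · exact (continuousOn_const.sub (continuousOn_const.mul (hcont.mono (by
          rw [uIcc_of_le hst]; exact Icc_subset_Ici_self.trans (Ici_subset_Ici.2 h0s))))
          ).intervalIntegrable
      · have hA : ∀ j, ∀ᵐ τ, τ ∈ Ioi (0 : ℝ) → v j τ ∈ domainA := fun j =>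
          (ae_restrict_iff' measurableSet_Ioi).1 (hv.mem_domainA j)
        have hne : ∀ᵐ τ : ℝ, τ ≠ 0 := by simp [ae_iff]
        rw [EventuallyLE, ae_restrict_iff' measurableSet_Icc]
        filter_upwards [ae_all_iff.2 hA, hT, hne] with τ hAτ hTτ hτ0 hτ
        have hpos : 0 < τ := lt_of_le_of_ne (h0s.trans hτ.1) (Ne.symm hτ0)
        simp only [hf]
        rw [fourierCoefficient_vectorField_sub hk (fun j => hAτ j hpos) i]
        refine (two_mul_re_mul_conj_le hl0).trans (sub_le_sub_right ?_ _)
        refine div_le_div_of_nonneg_right (pow_le_pow_left₀ (norm_nonneg _) ?_ 2) hl0.le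
        exact (norm_fourierCoefficient_le _ _ _).trans (hTτ (hTs.trans hτ.1))
  have h2 := (Real.continuous_sqrt.tendsto 0).comp hsq
  simpa [Function.comp_def, Real.sqrt_sq (norm_nonneg _)] using h2

lemma IsSolution.tendsto_lowModeSize (hν : 0 < ν) (hs : IsSynchronousPair g)
    (hv : IsSolution ν K (symMatrix (1 / 2) (1 / 2)) g v) :
    Tendsto (fun t => lowModeSize K (v 0 t - v 1 t)) atTop (𝓝 0) := by
  have h : Tendsto (fun t => lowModeSize K (v 0 t - v 1 t)) atTop
      (𝓝 (∑ _i : Fin 2, ∑ k ∈ modes K, waveLength k ^ 2 * 0)) :=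
    tendsto_finsetSum _ fun i _ => tendsto_finsetSum _ fun k hk =>
      (hv.tendsto_fourierCoefficient_sub hν hs (mem_modes.1 hk) i).const_mul _
  simpa using h

/-- Young's inequality leaves damping `ν‖v‖²`. The coupling amounts to `(B(v₁,v₁) - B(v₂,v₂), P_K A
δ)`, at most `2(ν/8)‖v‖²` in size, so at least `(ν/2)‖v‖²` of damping survives. -/
lemma sum_inner_vectorField_le (hν : 0 < ν) {t : ℝ} {G : Fin 2 → ℝ} (hG : ∀ j, ‖g j t‖ ≤ G j)
    (hV : ∀ j, v j t ∈ V) (hA : ∀ j, v j t ∈ domainA)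
    (hP : lowModeSize K (v 0 t - v 1 t) ≤ ν / 8) :
    ∑ i, 2 * inner ℝ (stokes (v i t)) (vectorField ν K (symMatrix (1 / 2) (1 / 2)) g v i t)
      ≤ (∑ i, G i ^ 2) / ν - ν / 2 * ∑ i, normV (v i t) ^ 2 := by
  have hd := sub_mem_domainA (hA 0) (hA 1)
  have hB0 := inner_stokes_B (hA 0) (hV 0)
  have hB1 := inner_stokes_B (hA 1) (hV 1)
  have hE0 := abs_le.1 (abs_inner_B_le K (hA 0) (hV 0) hd)
  have hE1 := abs_le.1 (abs_inner_B_le K (hA 1) (hV 1) hd)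
  -- Symmetry of `P_K` moves it onto `A δ`, so the four coupling terms combine into pairings with
  -- `P_K A δ`.
  have hmove : ∀ z : L2, inner ℝ z (trunc K (stokes (v 0 t - v 1 t)))
      = inner ℝ (stokes (v 0 t)) (trunc K z) - inner ℝ (stokes (v 1 t)) (trunc K z) := by
    intro z
    rw [← inner_trunc, stokes_sub (hA 0) (hA 1), inner_sub_right, real_inner_comm,
      real_inner_comm (stokes (v 1 t))]
  rw [hmove] at hE0 hE1
  have hforce : ∀ i, 2 * inner ℝ (stokes (v i t)) (g i t) - 2 * (ν * ‖stokes (v i t)‖ ^ 2)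
      ≤ G i ^ 2 / ν - ν * normV (v i t) ^ 2 := by
    intro i
    have h1 : inner ℝ (stokes (v i t)) (g i t) ≤ ‖stokes (v i t)‖ * G i :=
      (real_inner_le_norm _ _).trans (mul_le_mul_of_nonneg_left (hG i) (norm_nonneg _))
    have h2 : G i ^ 2 / ν + ν * ‖stokes (v i t)‖ ^ 2 - 2 * (‖stokes (v i t)‖ * G i)
        = (G i - ν * ‖stokes (v i t)‖) ^ 2 / ν := by
      field_simp
      ring
    have h3 : 0 ≤ (G i - ν * ‖stokes (v i t)‖) ^ 2 / ν := by positivity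
    have h4 : normV (v i t) ^ 2 ≤ ‖stokes (v i t)‖ ^ 2 :=
      pow_le_pow_left₀ (normV_nonneg _) (normV_le_norm_stokes (hV i) (hA i)) 2
    nlinarith [mul_le_mul_of_nonneg_left h4 hν.le]
  have hexp : ∀ i, inner ℝ (stokes (v i t))
      (vectorField ν K (symMatrix (1 / 2) (1 / 2)) g v i t)
      = inner ℝ (stokes (v i t)) (g i t) - ν * ‖stokes (v i t)‖ ^ 2
        - inner ℝ (stokes (v i t)) (B (v i t) (v i t))
        + ∑ j, symMatrix (1 / 2) (1 / 2) i j *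
          inner ℝ (stokes (v i t)) (trunc K (B (v j t) (v j t))) := by
    intro i
    simp only [vectorField, inner_add_right, inner_sub_right, inner_smul_right, inner_sum,
      lowModes_eq_trunc, real_inner_self_eq_norm_sq]
  have hp0 := mul_le_mul_of_nonneg_right hP (sq_nonneg (normV (v 0 t)))
  have hp1 := mul_le_mul_of_nonneg_right hP (sq_nonneg (normV (v 1 t)))
  have hf0 := hforce 0
  have hf1 := hforce 1
  simp only [Fin.sum_univ_two, hexp, hB0, hB1]
  simp only [symMatrix, Matrix.of_apply, Matrix.cons_val',
    Matrix.cons_val_zero, Matrix.cons_val_one, Matrix.cons_val_fin_one, add_div]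
  linarith [hE0.2, hE1.1]

lemma IsSolution.sum_normV_sq_sub_le (hν : 0 < ν) (hg : IsForce g) (hs : IsSynchronousPair g)
    (hv : IsSolution ν K (symMatrix (1 / 2) (1 / 2)) g v) :
    ∃ T, 0 ≤ T ∧ ∀ s t, T ≤ s → s ≤ t →
      ∑ i, normV (v i t) ^ 2 - ∑ i, normV (v i s) ^ 2 ≤ ∫ τ in s..t,
        ((∑ i, (eLpNorm (g i) ∞ (volume.restrict (Ioi 0))).toReal ^ 2) / ν -
          ν / 2 * ∑ i, normV (v i τ) ^ 2) := by
  obtain ⟨T, hT⟩ := eventually_atTop.1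
    ((hv.tendsto_lowModeSize hν hs).eventually (ge_mem_nhds (show 0 < ν / 8 by positivity)))
  -- Times stay strictly positive, inside the open half-line on which the almost-everywhere
  -- hypotheses hold.
  refine ⟨max T 1, by positivity, fun s t hTs hst => ?_⟩
  have h0s : 0 < s := zero_lt_one.trans_le ((le_max_right _ _).trans hTs)
  have h0t := h0s.trans_le hst
  have hen := fun i => normV_energy h0s.le hst (hv.integrable i t h0t.le)
    (fun τ hτ => hv.equation i τ hτ.1) (hv.mem_V i) (hv.mem_domainA i)
    (hv.stokes_memLp i t h0t) (hv.memLp_vectorField hν hg i h0t)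
  rw [← Finset.sum_sub_distrib, Finset.sum_congr rfl fun i _ => (hen i).2,
    ← intervalIntegral.integral_finsetSum fun i _ => (hen i).1]
  refine intervalIntegral.integral_mono_ae_restrict hst
    (intervalIntegrable_finsetSum _ fun i _ => (hen i).1) ?_ ?_
  · refine ContinuousOn.intervalIntegrable ?_
    refine (continuousOn_const.sub (continuousOn_const.mul (continuousOn_finsetSum _ fun i _ =>
      (hv.continuousOn_normV i).pow 2))).mono ?_
    rw [uIcc_of_le hst]
    exact Icc_subset_Ici_self.trans (Ici_subset_Ici.2 h0s.le)
  · have hsub : Icc s t ⊆ Ioi 0 := fun τ hτ => h0s.trans_le hτ.1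
    filter_upwards [ae_restrict_of_ae_restrict_of_subset hsub (ae_all_iff.2 hg.ae_norm_le),
      ae_restrict_of_ae_restrict_of_subset hsub (ae_all_iff.2 hv.mem_domainA),
      ae_restrict_mem measurableSet_Icc] with τ hGτ hAτ hτ
    exact sum_inner_vectorField_le hν hGτ (fun j => hv.mem_V j τ (h0s.le.trans hτ.1)) hAτ
      (hT τ ((le_max_left _ _).trans (hTs.trans hτ.1)))

lemma IsSolution.eventually_pairNormV_le (hν : 0 < ν) (hg : IsForce g)
    (hs : IsSynchronousPair g) (hv : IsSolution ν K (symMatrix (1 / 2) (1 / 2)) g v) {η : ℝ}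
    (hη : 0 < η) :
    ∀ᶠ t in atTop, pairNormV (fun i => v i t) ≤ 2 * ν * forceSize ν g + η := by
  obtain ⟨T, hT0, hT⟩ := hv.sum_normV_sq_sub_le hν hg hs
  have hev := eventually_le_of_integral_le (y := fun t => ∑ i, normV (v i t) ^ 2)
    (show 0 < ν / 2 by positivity)
    ((continuousOn_finsetSum _ fun i _ => (hv.continuousOn_normV i).pow 2).mono
      (Ici_subset_Ici.2 hT0)) hT (show 0 < η ^ 2 by positivity)
  filter_upwards [hev] with t ht
  have hF0 : 0 ≤ forceSize ν g := Real.sqrt_nonneg _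
  have hF : ν ^ 2 * forceSize ν g ^ 2
      = (∑ i, (eLpNorm (g i) ∞ (volume.restrict (Ioi 0))).toReal ^ 2) / ν ^ 2 := by
    rw [forceSize, Real.sq_sqrt (Finset.sum_nonneg fun _ _ => sq_nonneg _)]
    simp only [div_pow, ← Finset.sum_div]
    field_simp
  have h1 : (∑ i, (eLpNorm (g i) ∞ (volume.restrict (Ioi 0))).toReal ^ 2) / ν / (ν / 2)
      = 2 * (ν ^ 2 * forceSize ν g ^ 2) := by
    rw [hF]
    field_simp
  rw [h1] at ht
  rw [pairNormV]
  refine Real.sqrt_le_iff.2 ⟨by positivity, ht.trans ?_⟩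
  have h2 : 0 ≤ ν * forceSize ν g := by positivity
  -- With `x = ν𝔤` this is `2x² + η² ≤ (2x + η)²`.
  nlinarith [mul_nonneg h2 hη.le, sq_nonneg (ν * forceSize ν g)]

end Solution

end Intertwinement

end

theorem mainTheorem7 :
    ∃ C₁ : ℝ, 0 < C₁ ∧
      ∀ (ν K : ℝ), 0 < ν → 0 < K →
      ∀ (θ₁ θ₂ : ℝ), θ₁ = 1 / 2 → θ₂ = 1 / 2 →
      ∀ g v : Fin 2 → ℝ → Intertwinement.L2,
        Intertwinement.IsForce g →
        Intertwinement.IsSynchronousPair g →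
        Intertwinement.IsSolution ν K (Intertwinement.symMatrix θ₁ θ₂) g v →
        IsBoundedUnder (· ≤ ·) atTop (fun t : ℝ => Intertwinement.pairNormV (fun i => v i t)) ∧
        limsup (fun t : ℝ => Intertwinement.pairNormV (fun i => v i t)) atTop
          ≤ C₁ * ν * Intertwinement.forceSize ν g := by
  -- The argument yields `√2`; the value `2` merely avoids the root.
  refine ⟨2, two_pos, ?_⟩
  rintro ν K hν - θ₁ θ₂ rfl rfl g v hg hs hv
  have hev := fun η hη => hv.eventually_pairNormV_le hν hg hs (η := η) hη
  have hbdd : IsBoundedUnder (· ≤ ·) atTop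
      (fun t : ℝ => Intertwinement.pairNormV (fun i => v i t)) :=
    ⟨_, eventually_map.2 (hev 1 one_pos)⟩
  refine ⟨hbdd, le_of_forall_pos_le_add fun η hη => limsup_le_of_le ?_ (hev η hη)⟩
  -- Nonnegativity of the norm gives the lower bound that keeps the real `limsup` from being a
  -- default value.
  exact IsCoboundedUnder.of_frequently_ge
    (Eventually.of_forall fun _ => Real.sqrt_nonneg _).frequently
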